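/- **Setting.** A transmitter with $M_t\ge 1$ remote antenna units (RAUs) of $N_t$ antennas and a receiver with $M_r\ge 1$ RAUs of $N_r$ antennas use OFDM with $K$ subcarriers. On subcarrier $k=1,\dots,K$ the channel is the block matrix $\mathbf H[k]=(\mathbf H_{i,j}[k])_{i\le M_r,\,j\le M_t}$, $$\mathbf H_{i,j}[k]=\sqrt{\beta\tfrac{N_rN_t}{L}}\sum_{l=1}^{L}\alpha_{i,j}^l\,\mathbf a_r(\theta_{i,j}^l)\,\mathbf a_t(\phi_{i,j}^l)^H e^{-j2\pi\frac kK\frac{\tau_{i,j}^l}{T_s}},\qquad \mathbf a(\varphi)=\tfrac1{\sqrt N}\bigl[1,w(\varphi),\dots,w(\varphi)^{N-1}\bigr]^T,\quad w(\varphi)=e^{j\frac{2\pi}{\lambda}d\sin\varphi},$$ where $N=N_r$ for $\mathbf a_r$ and $N=N_t$ for $\mathbf a_t$, with $L\ge1$ paths, $\beta,\lambda,d,T_s>0$, independent gains $\alpha_{i,j}^l\sim\mathcal{CN}(0,1)$ and fixed delays and angles such that, for each $(i,j)$, the pairs $(w(\theta_{i,j}^l),w(\phi_{i,j}^l))$,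 $l=1,\dots,L$, are pairwise different. After beamforming, $N_s$ streams are received as $$y_s[k]=\sigma_s[k]\,x_s[k]+n_s[k],\qquad s=1,\dots,N_s,\ k=1,\dots,K,$$ where $\sigma_s[k]$ is the $s$-th largest singular value of $\mathbf H[k]$ and the $n_s[k]\sim\mathcal{CN}(0,N_t/\mathrm{SNR})$ are independent of each other and of the gains. A uniformly distributed frame of $T\ge1$ blocks of $k_c\ge1$ information bits is encoded by a binary convolutional encoder (terminated by zero blocks; injective on frames) with free distance $d_{\mathrm{free}}$, the minimum Hamming distance between different code sequences. A bijection $\pi:k'\mapsto(k,s,i)$ assigns the coded bits $c_{k'}$ of the frame to the subcarriers, streams and label positions of one OFDM symbol, and $x_s[k]\in\chi$ is the point of a finite constellation $\chi\subset\mathbb C$ whose points are labelled injectively by all binary words of a fixed length. The interleaver $\pi$ satisfies: (1) the frame is interleaved within one OFDM symbol; (2) for any two different codewords, every stream $s$ carries at least one bit in which they differ; (3) consecutive coded bits are on different subcarriers. The receiver knows the $\sigma_s[k]$ and chooses a codeword $\underline c$ minimizing $\sum_{k'}\min_{x\in\chi^i_{c_{k'}}}|y_s[k]-\sigma_s[k]x|^2$,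 where $(k,s,i)=\pi(k')$ and $\chi^i_b$ is the set of points with label bit $b$ in position $i$; ties are broken in any measurable way. Let $P_b(\mathrm{SNR};N_r,N_t)$ be the bit error rate: the expected fraction of wrong information bits, averaged over messages, noise and gains. **Theorem.** Put $G_d=\min(d_{\mathrm{free}},M_rM_tL)$. For all sufficiently large $N_r$ and $N_t$ the system achieves the diversity gain $G_d$: $$\liminf_{\mathrm{SNR}\to\infty}\frac{-\log P_b(\mathrm{SNR};N_r,N_t)}{\log \mathrm{SNR}}\ \ge\ G_d .$$ More precisely, there are $N_0$ and $c>0$ such that for all $N_r,N_t\ge N_0$ and all $\mathrm{SNR}>0$ $$P_b(\mathrm{SNR};N_r,N_t)\le c\,(N_r\,\mathrm{SNR})^{-G_d}.$$ If moreover $M_rM_tL\le d_{\mathrm{free}}$, then for all $N_r,N_t\ge N_0$ the diversity gain is exactly the full one: $$\lim_{\mathrm{SNR}\to\infty}\frac{-\log P_b(\mathrm{SNR};N_r,N_t)}{\log \mathrm{SNR}}=G_d=M_rM_tL .$$ -/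

import Mathlib

open MeasureTheory ProbabilityTheory Filter Topology
open scoped NNReal ENNReal ComplexConjugate

namespace BICMB

noncomputable section

/-! ### The wideband mm-Wave channel with distributed antenna subarrays -/

/-- The deterministic data of the channel between `Mt` transmit and `Mr` receive remote antenna
units, with `L` propagation paths for each pair of units. -/
structure Channel (Mr Mt L : ℕ) where
  /-- large-scale fading coefficient -/
  beta : ℝ
  /-- transmission wavelength -/
  wavelength : ℝ
  /-- antenna spacing -/
  spacing : ℝ
  /-- system sampling interval -/
  Ts : ℝ
  /-- angles of arrival -/
  theta : Fin Mr → Fin Mt → Fin L → ℝ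
  /-- angles of departure -/
  phi : Fin Mr → Fin Mt → Fin L → ℝ
  /-- path delays -/
  tau : Fin Mr → Fin Mt → Fin L → ℝ
  beta_pos : 0 < beta
  wavelength_pos : 0 < wavelength
  spacing_pos : 0 < spacing
  Ts_pos : 0 < Ts

namespace Channel

variable {Mr Mt L : ℕ}

/-- `exp (j (2π/λ) d sin φ)`: the phase factor between neighbouring antennas of a uniform linear
array for the angle `φ`. -/
def steer (C : Channel Mr Mt L) (angle : ℝ) : ℂ :=
  Complex.exp (Complex.I *
    ((2 * Real.pi / C.wavelength * C.spacing * Real.sin angle : ℝ) : ℂ))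

/-- The normalized array response of a uniform linear array of `N` antennas. -/
def arrayResponse (C : Channel Mr Mt L) (N : ℕ) (angle : ℝ) (p : Fin N) : ℂ :=
  ((1 / Real.sqrt N : ℝ) : ℂ) * C.steer angle ^ (p : ℕ)

/-- The frequency-domain channel matrix `H[k]`, `k = 1, …, K` (so `k : Fin K` stands for the
subcarrier with number `k + 1`), as a function of the complex path gains `α i j l`.
Rows are pairs (receive unit, antenna), columns are pairs (transmit unit, antenna). -/
def matrix (C : Channel Mr Mt L) (Nr Nt : ℕ) {K : ℕ}
    (α : Fin Mr × Fin Mt × Fin L → ℂ) (k : Fin K) :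
    Matrix (Fin Mr × Fin Nr) (Fin Mt × Fin Nt) ℂ :=
  fun r c =>
    ((Real.sqrt (C.beta * ((Nr : ℝ) * Nt / L)) : ℝ) : ℂ) *
      ∑ l : Fin L,
        α (r.1, c.1, l) * C.arrayResponse Nr (C.theta r.1 c.1 l) r.2 *
          conj (C.arrayResponse Nt (C.phi r.1 c.1 l) c.2) *
          Complex.exp (-(Complex.I *
            ((2 * Real.pi * (((k : ℕ) + 1 : ℝ) / K) * (C.tau r.1 c.1 l / C.Ts) : ℝ) : ℂ)))

/-- The gain `σ_s[k]` of stream `s` on subcarrier `k`: the `s`-th largest singular value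
of `H[k]` (`s = 0` is the largest one). -/
def gain (C : Channel Mr Mt L) (Nr Nt : ℕ) {K Ns : ℕ}
    (α : Fin Mr × Fin Mt × Fin L → ℂ) (k : Fin K) (s : Fin Ns) : ℝ :=
  (Matrix.toEuclideanLin (C.matrix Nr Nt α k)).singularValues s

/-- Two different paths between the same pair of units never have the same array response
both at the receiver and at the transmitter. -/
def PathsDistinct (C : Channel Mr Mt L) : Prop :=
  ∀ i j, Function.Injective fun l : Fin L =>
    (C.steer (C.theta i j l), C.steer (C.phi i j l))

end Channel

/-- The circularly symmetric complex Gaussian distribution `CN(0, v)`. -/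
def complexGaussian (v : ℝ≥0) : Measure ℂ :=
  ((gaussianReal 0 (v / 2)).prod (gaussianReal 0 (v / 2))).map fun p => (⟨p.1, p.2⟩ : ℂ)

/-! ### Convolutional codes -/

/-- A binary convolutional encoder with `kc` input bits and `nc` output bits per trellis step and
memory `ν`, given by its generator taps. -/
def ConvEncoder (kc nc ν : ℕ) : Type := Fin kc → Fin nc → Fin (ν + 1) → ZMod 2

namespace ConvEncoder

variable {kc nc ν : ℕ}

/-- The code sequence of an (infinite) information sequence; the encoder starts in the
zero state. -/
def encode (g : ConvEncoder kc nc ν) (u : ℕ → Fin kc → ZMod 2) (t : ℕ) (j : Fin nc) : ZMod 2 :=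
  ∑ i : Fin kc, ∑ l : Fin (ν + 1), if (l : ℕ) ≤ t then g i j l * u (t - l) i else 0

/-- The free distance: the minimum Hamming distance between different code sequences. -/
def freeDistance (g : ConvEncoder kc nc ν) : ℕ :=
  sInf {d : ℕ | ∃ u v : ℕ → Fin kc → ZMod 2, g.encode u ≠ g.encode v ∧
    {p : ℕ × Fin nc | g.encode u p.1 p.2 ≠ g.encode v p.1 p.2}.encard = d}

end ConvEncoder

/-- The information bits of a frame of `T` trellis steps. -/
abbrev Message (T kc : ℕ) : Type := Fin T → Fin kc → ZMod 2

/-- The sequence of coded bits of a frame: `T` information blocks, followed by `ν` zero blocks that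
return the encoder to the zero state. -/
def codeword {kc nc ν : ℕ} (g : ConvEncoder kc nc ν) {T : ℕ} (u : Message T kc)
    (q : Fin ((T + ν) * nc)) : ZMod 2 :=
  g.encode (fun t => if h : t < T then u ⟨t, h⟩ else 0)
    (finProdFinEquiv.symm q).1 (finProdFinEquiv.symm q).2

/-! ### Bit interleaver, modulation, and decoder -/

/-- A bit interleaver `π : k' ↦ (k, s, i)`: the coded bit number `k'` goes to subcarrier `k`,
stream (subchannel) `s` and label position `i`. All `n` coded bits of the frame fill
one OFDM symbol. -/
abbrev Interleaver (n K Ns m : ℕ) : Type := Fin n ≃ Fin K × Fin Ns × Fin m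

/-- The interleaver design criteria. (That consecutive coded bits stay within one OFDM symbol is part
of `Interleaver`.) -/
structure DesignCriteria {kc nc ν T K Ns m : ℕ} (g : ConvEncoder kc nc ν)
    (π : Interleaver ((T + ν) * nc) K Ns m) : Prop where
  /-- Every subchannel carries at least one of the bits in which two different codewords differ. -/
  uses_all_subchannels : ∀ u v : Message T kc, codeword g u ≠ codeword g v →
    ∀ s : Fin Ns, ∃ q, codeword g u q ≠ codeword g v q ∧ (π q).2.1 = s
  /-- Consecutive coded bits are transmitted over different subcarriers. -/
  consecutive : ∀ q q' : Fin ((T + ν) * nc), (q' : ℕ) = q + 1 → (π q).1 ≠ (π q').1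

section System

variable {kc nc ν T K Ns m : ℕ}

/-- The transmitted symbol `x_s[k]`; the constellation is given by its labelling `χ`. -/
def symbol (g : ConvEncoder kc nc ν) (χ : (Fin m → ZMod 2) → ℂ)
    (π : Interleaver ((T + ν) * nc) K Ns m) (u : Message T kc) (k : Fin K) (s : Fin Ns) : ℂ :=
  χ fun i => codeword g u (π.symm (k, s, i))

/-- The ML bit metric `γ^i(y, b) = min_{x ∈ χ_b^i} |y - σ x|²`. -/
def bitMetric (χ : (Fin m → ZMod 2) → ℂ) (y : ℂ) (σ : ℝ) (i : Fin m) (b : ZMod 2) : ℝ :=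
  ⨅ a : {a : Fin m → ZMod 2 // a i = b}, ‖y - σ * χ a‖ ^ 2

/-- The decoding metric of the codeword of the message `u`. -/
def codeMetric (g : ConvEncoder kc nc ν) (χ : (Fin m → ZMod 2) → ℂ)
    (π : Interleaver ((T + ν) * nc) K Ns m) (y : Fin K → Fin Ns → ℂ) (σ : Fin K → Fin Ns → ℝ)
    (u : Message T kc) : ℝ :=
  ∑ q, bitMetric χ (y (π q).1 (π q).2.1) (σ (π q).1 (π q).2.1) (π q).2.2 (codeword g u q)

/-- A decoder knows the received signals and the gains, and returns a message. -/
abbrev Decoder (K Ns T kc : ℕ) : Type :=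
  (Fin K → Fin Ns → ℂ) → (Fin K → Fin Ns → ℝ) → Message T kc

/-- The decoder minimizes the sum of the bit metrics over all codewords (ties are broken
in any measurable way). -/
structure IsMLDecoder (g : ConvEncoder kc nc ν) (χ : (Fin m → ZMod 2) → ℂ)
    (π : Interleaver ((T + ν) * nc) K Ns m) (dec : Decoder K Ns T kc) : Prop where
  isMin : ∀ y σ u, codeMetric g χ π y σ (dec y σ) ≤ codeMetric g χ π y σ u
  measurable : ∀ σ u, MeasurableSet {y | dec y σ = u}

/-- The number of information bits in which two messages differ. -/
def bitErrors (u v : Message T kc) : ℕ :=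
  (Finset.univ.filter fun p : Fin T × Fin kc => u p.1 p.2 ≠ v p.1 p.2).card

/-- The bit error rate for given gains `σ` and noise variance `N₀`: the expected fraction of wrong
information bits, for a uniformly distributed message, when
`y_s[k] = σ_s[k] x_s[k] + n_s[k]` with independent `n_s[k] ∼ CN(0, N₀)`. -/
def conditionalBER (g : ConvEncoder kc nc ν) (χ : (Fin m → ZMod 2) → ℂ)
    (π : Interleaver ((T + ν) * nc) K Ns m) (dec : Decoder K Ns T kc)
    (σ : Fin K → Fin Ns → ℝ) (N₀ : ℝ≥0) : ℝ≥0∞ :=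
  (Fintype.card (Message T kc) : ℝ≥0∞)⁻¹ * ∑ u : Message T kc,
    ∫⁻ n : Fin K → Fin Ns → ℂ,
      (bitErrors u (dec (fun k s => σ k s * symbol g χ π u k s + n k s) σ) : ℝ≥0∞) / (T * kc : ℕ)
      ∂(Measure.pi fun _ => Measure.pi fun _ => complexGaussian N₀)

/-- The bit error rate `P_b` of the system with `Nr` and `Nt` antennas per unit at a given SNR: the
mean of the conditional bit error rate over independent path gains `α i j l ∼ CN(0, 1)`, with noise
variance `Nt / SNR`. -/
def bitErrorRate {Mr Mt L : ℕ} (C : Channel Mr Mt L) (g : ConvEncoder kc nc ν)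
    (χ : (Fin m → ZMod 2) → ℂ) (π : Interleaver ((T + ν) * nc) K Ns m) (dec : Decoder K Ns T kc)
    (Nr Nt : ℕ) (snr : ℝ) : ℝ :=
  (∫⁻ α : Fin Mr × Fin Mt × Fin L → ℂ,
    conditionalBER g χ π dec (fun k s => C.gain Nr Nt α k s) (Real.toNNReal (Nt / snr))
    ∂(Measure.pi fun _ => complexGaussian 1)).toReal

end System

/-! ### Diversity gain -/

/-- The diversity gain (order) of an error rate: `liminf (- log P(SNR) / log SNR)` at high SNR. -/
def diversityGain (P : ℝ → ℝ) : EReal :=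
  liminf (fun snr : ℝ => ((-Real.log (P snr) / Real.log snr : ℝ) : EReal)) atTop

end

end BICMB

namespace BICMB

/-! ### Gaussian measures -/

/-! Put D = `Mr * Mt * L`, the number of independent path gains. The error rate is squeezed between
two constant multiples of SNR^(-D), for fixed large antenna numbers. So its exponent is D itself,
and the claims about the minimum with the free distance follow because that minimum is at most D.

Upper bound. For long arrays, responses with different steering factors are almost orthogonal.
Testing the channel matrix on the responses of its strongest path shows that the squared largest
singular value is at least a constant times Nr Nt ‖α‖² on every subcarrier
(`Channel.exists_le_sq_gain`). Two different codewords differ somewhere on the first stream, so a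
decoding error forces some noise sample to be at least proportional to the smallest first-stream
gain (`exists_noise_of_error`). Chernoff and union bounds give a conditional error rate of order
exp(-s‖α‖²), with s proportional to Nr SNR (`conditionalBER_le`), and averaging over the D Gaussian
gains gives (1+s)^(-D).

Lower bound. With probability at least of order SNR^(-D) all path gains are of size at most 2
SNR^(-1/2). The received signal is then at most of the order of the noise, so the noise shifted by
any codeword dominates a fixed multiple of one common Gaussian measure. No decoder can be right for
two messages under the same measure, so the error rate stays bounded below on this event
(`le_conditionalBER`, `exists_le_bitErrorRate`). -/

theorem lintegral_exp_neg_mul_sq_gaussianReal {w : ℝ≥0} (hw : w ≠ 0) {s : ℝ}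
    (hs : 0 < 1 + 2 * s * w) :
    ∫⁻ x, ENNReal.ofReal (Real.exp (-s * x ^ 2)) ∂(gaussianReal 0 w) =
      ENNReal.ofReal (√(1 + 2 * s * w))⁻¹ := by
  have hw' : (0 : ℝ) < w := by positivity
  have hb : 0 < s + (2 * (w : ℝ))⁻¹ := by
    have : s + (2 * (w : ℝ))⁻¹ = (1 + 2 * s * w) / (2 * w) := by field_simp; ring
    rw [this]; positivity
  rw [gaussianReal_of_var_ne_zero _ hw, lintegral_withDensity_eq_lintegral_mul _
    (measurable_gaussianPDF 0 w) (by fun_prop)]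
  have heq : ∀ x : ℝ, (gaussianPDF 0 w * fun x => ENNReal.ofReal (Real.exp (-s * x ^ 2))) x =
      ENNReal.ofReal ((√(2 * Real.pi * w))⁻¹ * Real.exp (-(s + (2 * (w : ℝ))⁻¹) * x ^ 2)) := by
    intro x
    simp only [Pi.mul_apply, gaussianPDF, gaussianPDFReal]
    rw [← ENNReal.ofReal_mul (by positivity), mul_assoc, ← Real.exp_add]
    congr 3
    field_simp
    ring
  simp_rw [heq]
  rw [← ofReal_integral_eq_lintegral_ofReal ((integrable_exp_neg_mul_sq hb).const_mul _)
    (Eventually.of_forall fun x => by positivity), integral_const_mul, integral_gaussian]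
  congr 1
  rw [← Real.sqrt_inv, ← Real.sqrt_inv, ← Real.sqrt_mul (by positivity)]
  congr 1
  have : s + (2 * (w : ℝ))⁻¹ = (1 + 2 * s * w) / (2 * w) := by field_simp; ring
  rw [this]
  have := Real.pi_pos
  field_simp

instance isProbabilityMeasure_complexGaussian (v : ℝ≥0) :
    IsProbabilityMeasure (complexGaussian v) :=
  Measure.isProbabilityMeasure_map (by
    exact (Complex.measurableEquivRealProd.symm.measurable).aemeasurable)

theorem measurable_complex_mk : Measurable fun p : ℝ × ℝ => (⟨p.1, p.2⟩ : ℂ) :=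
  Complex.measurableEquivRealProd.symm.measurable

theorem lintegral_exp_neg_mul_normSq_complexGaussian {v : ℝ≥0} (hv : v ≠ 0) {s : ℝ}
    (hs : 0 < 1 + s * v) :
    ∫⁻ z, ENNReal.ofReal (Real.exp (-s * ‖z‖ ^ 2)) ∂(complexGaussian v) =
      ENNReal.ofReal (1 + s * v)⁻¹ := by
  have hw : v / 2 ≠ 0 := by positivity
  have hs' : 1 + 2 * s * ((v / 2 : ℝ≥0) : ℝ) = 1 + s * v := by push_cast; ring
  rw [complexGaussian, lintegral_map (by fun_prop) measurable_complex_mk]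
  have heq : ∀ p : ℝ × ℝ, ENNReal.ofReal (Real.exp (-s * ‖(⟨p.1, p.2⟩ : ℂ)‖ ^ 2)) =
      ENNReal.ofReal (Real.exp (-s * p.1 ^ 2)) * ENNReal.ofReal (Real.exp (-s * p.2 ^ 2)) := by
    intro p
    rw [← ENNReal.ofReal_mul (by positivity), ← Real.exp_add, Complex.sq_norm,
      Complex.normSq_mk]
    ring_nf
  simp_rw [heq]
  rw [lintegral_prod_mul (f := fun x : ℝ => ENNReal.ofReal (Real.exp (-s * x ^ 2)))
    (g := fun x : ℝ => ENNReal.ofReal (Real.exp (-s * x ^ 2))) (by fun_prop) (by fun_prop),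
    lintegral_exp_neg_mul_sq_gaussianReal hw (by rw [hs']; exact hs), hs',
    ← ENNReal.ofReal_mul (by positivity), ← mul_inv, Real.mul_self_sqrt hs.le]

/-- Since (x-a)² ≤ 2x² + 2a², a shifted density dominates a multiple of the centred density of half
the variance. The dominated measure does not depend on the direction of the shift, which makes
different transmitted signals comparable. The √2 is the ratio of the normalizing constants. -/
theorem smul_gaussianReal_le_map_add {w : ℝ≥0} (hw : w ≠ 0) (a : ℝ) :
    ENNReal.ofReal (Real.exp (-(a ^ 2 / w)) / √2) • gaussianReal 0 (w / 2) ≤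
      (gaussianReal 0 w).map (a + ·) := by
  have hw' : (0 : ℝ) < w := by positivity
  rw [gaussianReal_map_const_add, gaussianReal_of_var_ne_zero _ hw,
    gaussianReal_of_var_ne_zero _ (by positivity : w / 2 ≠ 0),
    ← withDensity_smul _ (measurable_gaussianPDF _ _)]
  refine withDensity_mono (Eventually.of_forall fun x => ?_)
  simp only [Pi.smul_apply, smul_eq_mul, gaussianPDF, gaussianPDFReal]
  rw [← ENNReal.ofReal_mul (by positivity)]
  refine ENNReal.ofReal_le_ofReal ?_
  have h1 : √(2 * Real.pi * w) = √2 * √(2 * Real.pi * ((w / 2 : ℝ≥0) : ℝ)) := by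
    rw [← Real.sqrt_mul (by positivity)]; congr 1; push_cast; ring
  rw [h1, div_eq_mul_inv, mul_inv]
  have h2 : Real.exp (-(a ^ 2 / w)) * Real.exp (-(x - 0) ^ 2 / (2 * ((w / 2 : ℝ≥0) : ℝ))) ≤
      Real.exp (-(x - (0 + a)) ^ 2 / (2 * w)) := by
    rw [← Real.exp_add, Real.exp_le_exp]
    push_cast
    have : -(a ^ 2 / (w : ℝ)) + -(x - 0) ^ 2 / (2 * (w / 2)) = -(2 * a ^ 2 + 2 * x ^ 2) / (2 * w) := by
      field_simp; ring
    rw [this]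
    gcongr
    nlinarith [sq_nonneg (x + a)]
  calc _ = (√2)⁻¹ * (√(2 * Real.pi * ((w / 2 : ℝ≥0) : ℝ)))⁻¹ *
      (Real.exp (-(a ^ 2 / w)) * Real.exp (-(x - 0) ^ 2 / (2 * ((w / 2 : ℝ≥0) : ℝ)))) := by ring
    _ ≤ _ := by gcongr

theorem smul_complexGaussian_le_map_add {v : ℝ≥0} (hv : v ≠ 0) (a : ℂ) :
    ENNReal.ofReal (Real.exp (-(2 * ‖a‖ ^ 2 / v)) / 2) • complexGaussian (v / 2) ≤
      (complexGaussian v).map (a + ·) := by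
  have hw : v / 2 ≠ 0 := by positivity
  have hv' : (0 : ℝ) < v := by positivity
  have h := Measure.prod_mono (smul_gaussianReal_le_map_add hw a.re)
    (smul_gaussianReal_le_map_add hw a.im)
  rw [Measure.prod_smul_left, Measure.prod_smul_right, smul_smul,
    Measure.map_prod_map _ _ (by fun_prop) (by fun_prop)] at h
  have h' := Measure.map_mono h measurable_complex_mk
  rw [Measure.map_smul, Measure.map_map measurable_complex_mk (by fun_prop)] at h'
  rw [complexGaussian, complexGaussian, Measure.map_map (by fun_prop) measurable_complex_mk]
  convert h' using 2
  swap
  · funext p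
    apply Complex.ext <;> simp
  rw [← ENNReal.ofReal_mul (by positivity)]
  congr 1
  rw [div_mul_div_comm, ← Real.exp_add, Real.mul_self_sqrt (by norm_num), Complex.sq_norm,
    Complex.normSq_apply]
  congr 2
  push_cast
  field_simp
  ring

/-- The product outer measure is the largest one bounded on boxes by the product of the side
measures, so the comparison need only be made on boxes. -/
theorem smul_pi_le_pi {ι : Type*} [Fintype ι] {X : ι → Type*} [∀ i, MeasurableSpace (X i)]
    {μ ν : ∀ i, Measure (X i)} [∀ i, SigmaFinite (ν i)] {κ : ℝ≥0∞}
    (h : ∀ i, κ • ν i ≤ μ i) :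
    κ ^ Fintype.card ι • Measure.pi ν ≤ Measure.pi μ := by
  refine Measure.le_iff.2 fun s hs => ?_
  rw [Measure.pi_def μ, toMeasure_apply _ _ hs]
  have : (κ ^ Fintype.card ι • Measure.pi ν).toOuterMeasure ≤
      OuterMeasure.pi fun i => (μ i).toOuterMeasure := by
    refine OuterMeasure.le_pi.2 fun t _ => ?_
    change (κ ^ Fintype.card ι • Measure.pi ν) (Set.univ.pi t) ≤ ∏ i, μ i (t i)
    rw [Measure.smul_apply, Measure.pi_pi, smul_eq_mul, ← Finset.card_univ, ← Finset.prod_const,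
      ← Finset.prod_mul_distrib]
    exact Finset.prod_le_prod' fun i _ => h i (t i)
  exact this s

theorem smul_pi_complexGaussian_le_map_add {ι : Type*} [Fintype ι] {v : ℝ≥0} (hv : v ≠ 0)
    {a : ι → ℂ} {R : ℝ} (ha : ∀ i, 2 * ‖a i‖ ^ 2 / v ≤ R) :
    ENNReal.ofReal (Real.exp (-R) / 2) ^ Fintype.card ι •
        Measure.pi (fun _ : ι => complexGaussian (v / 2)) ≤
      (Measure.pi fun _ : ι => complexGaussian v).map (a + ·) := by
  have hmap := Measure.pi_map_pi (μ := fun _ : ι => complexGaussian v)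
    (f := fun i z => a i + z) (hμ := fun i => by
      have := Measure.isProbabilityMeasure_map (μ := complexGaussian v) (f := fun z => a i + z)
        (by fun_prop)
      infer_instance) (fun i => by fun_prop)
  change _ ≤ (Measure.pi fun _ : ι => complexGaussian v).map (fun x i => a i + x i)
  rw [hmap]
  refine smul_pi_le_pi fun i => le_trans ?_ (smul_complexGaussian_le_map_add hv (a i))
  gcongr
  exact ha i

theorem smul_pi_pi_complexGaussian_le_map_add {ι κ : Type*} [Fintype ι] [Fintype κ] {v : ℝ≥0}
    (hv : v ≠ 0) {a : ι → κ → ℂ} {R : ℝ} (ha : ∀ i j, 2 * ‖a i j‖ ^ 2 / v ≤ R) :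
    (ENNReal.ofReal (Real.exp (-R) / 2) ^ Fintype.card κ) ^ Fintype.card ι •
        Measure.pi (fun _ : ι => Measure.pi fun _ : κ => complexGaussian (v / 2)) ≤
      (Measure.pi fun _ : ι => Measure.pi fun _ : κ => complexGaussian v).map (a + ·) := by
  have hmap := Measure.pi_map_pi (μ := fun _ : ι => Measure.pi fun _ : κ => complexGaussian v)
    (f := fun i z => a i + z) (hμ := fun i => by
      have := Measure.isProbabilityMeasure_map (μ := Measure.pi fun _ : κ => complexGaussian v)
        (f := fun z => a i + z) (by fun_prop)
      infer_instance) (fun i => by fun_prop)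
  change _ ≤ (Measure.pi fun _ : ι => Measure.pi fun _ : κ => complexGaussian v).map
    (fun x i => a i + x i)
  rw [hmap]
  exact smul_pi_le_pi fun i => smul_pi_complexGaussian_le_map_add hv (ha i)

theorem lintegral_pi_prod {ι : Type*} [Fintype ι] {X : ι → Type*} [∀ i, MeasurableSpace (X i)]
    (μ : ∀ i, Measure (X i)) [∀ i, IsProbabilityMeasure (μ i)] {f : ∀ i, X i → ℝ≥0∞}
    (hf : ∀ i, Measurable (f i)) :
    ∫⁻ x, ∏ i, f i (x i) ∂(Measure.pi μ) = ∏ i, ∫⁻ z, f i z ∂(μ i) := by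
  have hind : iIndepFun (fun i (x : ∀ i, X i) => f i (x i)) (Measure.pi μ) :=
    iIndepFun_pi (fun i => (hf i).aemeasurable)
  rw [lintegral_prod_eq_prod_lintegral_of_indepFun Finset.univ _ hind
    fun i => (hf i).comp (measurable_pi_apply i)]
  exact Finset.prod_congr rfl fun i _ => (measurePreserving_eval μ i).lintegral_comp (hf i)

/-- Independence turns the average into a product with one factor 1/(1+s) per path gain; this is
where the diversity order of the upper bound comes from. -/
theorem lintegral_pi_exp_neg_mul_sum {ι : Type*} [Fintype ι] {s : ℝ} (hs : 0 ≤ s) :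
    ∫⁻ α : ι → ℂ, ENNReal.ofReal (Real.exp (-s * ∑ i, ‖α i‖ ^ 2))
      ∂(Measure.pi fun _ => complexGaussian 1) =
      ENNReal.ofReal ((1 + s)⁻¹ ^ Fintype.card ι) := by
  have h : ∀ α : ι → ℂ, ENNReal.ofReal (Real.exp (-s * ∑ i, ‖α i‖ ^ 2)) =
      ∏ i, ENNReal.ofReal (Real.exp (-s * ‖α i‖ ^ 2)) := by
    intro α
    rw [Finset.mul_sum, Real.exp_sum, ENNReal.ofReal_prod_of_nonneg fun i _ => by positivity]
  simp_rw [h]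
  rw [lintegral_pi_prod _ (f := fun _ z => ENNReal.ofReal (Real.exp (-s * ‖z‖ ^ 2)))
    (fun _ => by fun_prop)]
  simp_rw [lintegral_exp_neg_mul_normSq_complexGaussian one_ne_zero
    (show 0 < 1 + s * ((1 : ℝ≥0) : ℝ) by simp; positivity)]
  rw [Finset.prod_const, Finset.card_univ, NNReal.coe_one, mul_one,
    ← ENNReal.ofReal_pow (by positivity)]

theorem le_gaussianReal_Icc {w : ℝ≥0} (hw : w ≠ 0) {r : ℝ} (hr : r ≤ 1) :
    ENNReal.ofReal (2 * gaussianPDFReal 0 w 1 * r) ≤ gaussianReal 0 w (Set.Icc (-r) r) := by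
  rw [gaussianReal_apply _ hw]
  calc ENNReal.ofReal (2 * gaussianPDFReal 0 w 1 * r)
      = ∫⁻ x in Set.Icc (-r) r, gaussianPDF 0 w 1 := by
        rw [setLIntegral_const, Real.volume_Icc, gaussianPDF,
          ← ENNReal.ofReal_mul (gaussianPDFReal_nonneg _ _ _)]
        congr 1; ring
    _ ≤ _ := by
        refine setLIntegral_mono (measurable_gaussianPDF _ _) fun x hx => ?_
        refine ENNReal.ofReal_le_ofReal ?_
        simp only [gaussianPDFReal]
        have : (x - 0) ^ 2 ≤ (1 - 0) ^ 2 := by nlinarith [hx.1, hx.2]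
        exact mul_le_mul_of_nonneg_left (Real.exp_le_exp.2 (by gcongr)) (by positivity)

/-- The disc contains the square of half-width r, on which both real densities are at least their
value at 1. The order r² per complex gain yields SNR^(-1) for r = SNR^(-1/2). -/
theorem exists_le_complexGaussian_ball :
    ∃ c : ℝ, 0 < c ∧ ∀ r : ℝ, 0 ≤ r → r ≤ 1 →
      ENNReal.ofReal (c * r ^ 2) ≤ complexGaussian 1 {z | ‖z‖ ≤ 2 * r} := by
  have hw : (1 / 2 : ℝ≥0) ≠ 0 := by positivity
  have hp := gaussianPDFReal_pos 0 (1 / 2 : ℝ≥0) 1 hw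
  refine ⟨(2 * gaussianPDFReal 0 (1 / 2) 1) ^ 2, by positivity, fun r hr0 hr1 => ?_⟩
  have hmeas : MeasurableSet {z : ℂ | ‖z‖ ≤ 2 * r} :=
    measurableSet_le (by fun_prop) measurable_const
  rw [complexGaussian, Measure.map_apply measurable_complex_mk hmeas]
  calc ENNReal.ofReal ((2 * gaussianPDFReal 0 (1 / 2) 1) ^ 2 * r ^ 2)
      = ENNReal.ofReal (2 * gaussianPDFReal 0 (1 / 2) 1 * r) *
        ENNReal.ofReal (2 * gaussianPDFReal 0 (1 / 2) 1 * r) := by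
        rw [← ENNReal.ofReal_mul (by positivity)]; congr 1; ring
    _ ≤ gaussianReal 0 (1 / 2) (Set.Icc (-r) r) * gaussianReal 0 (1 / 2) (Set.Icc (-r) r) :=
        mul_le_mul' (le_gaussianReal_Icc hw hr1) (le_gaussianReal_Icc hw hr1)
    _ = ((gaussianReal 0 (1 / 2)).prod (gaussianReal 0 (1 / 2)))
        (Set.Icc (-r) r ×ˢ Set.Icc (-r) r) := (Measure.prod_prod _ _).symm
    _ ≤ _ := by
        refine measure_mono fun p hp => ?_
        have h1 : |p.1| ≤ r := abs_le.2 hp.1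
        have h2 : |p.2| ≤ r := abs_le.2 hp.2
        have := Complex.norm_le_abs_re_add_abs_im ⟨p.1, p.2⟩
        simp only [Set.mem_preimage, Set.mem_ofPred_eq]
        linarith

/-! ### The largest singular value -/

theorem inner_self_eq_ofReal_norm_sq {E : Type*} [NormedAddCommGroup E] [InnerProductSpace ℂ E]
    (x : E) : inner ℂ x x = ((‖x‖ ^ 2 : ℝ) : ℂ) := by
  rw [inner_self_eq_norm_sq_to_K]
  push_cast
  rfl

section SingularValues

variable {E F : Type*} [NormedAddCommGroup E] [InnerProductSpace ℂ E] [FiniteDimensional ℂ E]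
  [NormedAddCommGroup F] [InnerProductSpace ℂ F] [FiniteDimensional ℂ F]

/-- Expand x in an orthonormal eigenbasis of A*A: ‖Ax‖² is the sum of the squared coefficients
weighted by the squared singular values, of which the one with index 0 is the largest. -/
theorem norm_apply_le_singularValues_zero_mul (A : E →ₗ[ℂ] F) (x : E) :
    ‖A x‖ ≤ A.singularValues 0 * ‖x‖ := by
  rcases Nat.eq_zero_or_pos (Module.finrank ℂ E) with h0 | hpos
  · have := Module.finrank_zero_iff.1 h0
    simp [Subsingleton.elim x 0]
  set hA := A.isSymmetric_adjoint_comp_self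
  set b := hA.eigenvectorBasis rfl
  have h1 : ‖A x‖ ^ 2 = ∑ i : Fin (Module.finrank ℂ E), A.singularValues i ^ 2 * ‖inner ℂ (b i) x‖ ^ 2 := by
    have h2 : ((‖A x‖ ^ 2 : ℝ) : ℂ) = inner ℂ x ((LinearMap.adjoint A ∘ₗ A) x) := by
      rw [LinearMap.comp_apply, LinearMap.adjoint_inner_right, inner_self_eq_ofReal_norm_sq]
    have h3 : inner ℂ x ((LinearMap.adjoint A ∘ₗ A) x) =
        ((∑ i : Fin (Module.finrank ℂ E), A.singularValues i ^ 2 * ‖inner ℂ (b i) x‖ ^ 2 : ℝ) : ℂ) := by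
      rw [← b.sum_inner_mul_inner]
      push_cast
      refine Finset.sum_congr rfl fun i _ => ?_
      have : inner ℂ (b i) ((LinearMap.adjoint A ∘ₗ A) x) =
          ((A.singularValues i ^ 2 : ℝ) : ℂ) * inner ℂ (b i) x := by
        rw [← hA (b i) x, hA.apply_eigenvectorBasis rfl i, inner_smul_left,
          A.sq_singularValues_fin rfl i]
        congr 1
        exact Complex.conj_ofReal _
      change inner ℂ x (b i) * inner ℂ (b i) ((LinearMap.adjoint A ∘ₗ A) x) = _
      rw [this, ← inner_conj_symm x (b i), mul_left_comm, Complex.conj_mul']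
      push_cast
      ring
    exact_mod_cast h2.trans h3
  have h4 : ‖A x‖ ^ 2 ≤ (A.singularValues 0 * ‖x‖) ^ 2 := by
    rw [h1, mul_pow, ← b.sum_sq_norm_inner_right x, Finset.mul_sum]
    refine Finset.sum_le_sum fun i _ => ?_
    have := A.singularValues_antitone (Nat.zero_le i)
    have := A.singularValues_nonneg i
    gcongr
  exact le_of_sq_le_sq h4 (mul_nonneg (A.singularValues_nonneg 0) (norm_nonneg x))

theorem singularValues_le_of_norm_apply_le (A : E →ₗ[ℂ] F) {c : ℝ} (hc : 0 ≤ c)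
    (h : ∀ x, ‖A x‖ ≤ c * ‖x‖) (n : ℕ) : A.singularValues n ≤ c := by
  by_cases hn : n < Module.finrank ℂ E
  · obtain ⟨v, hv⟩ := (A.hasEigenvalue_adjoint_comp_self_sq_singularValues hn).exists_hasEigenvector
    have hv0 : 0 < ‖v‖ := norm_pos_iff.2 hv.2
    have h1 : ‖A v‖ ^ 2 = A.singularValues n ^ 2 * ‖v‖ ^ 2 := by
      have h2 : ((‖A v‖ ^ 2 : ℝ) : ℂ) = inner ℂ v ((LinearMap.adjoint A ∘ₗ A) v) := by
        rw [LinearMap.comp_apply, LinearMap.adjoint_inner_right, inner_self_eq_ofReal_norm_sq]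
      rw [hv.apply_eq_smul, inner_smul_right, inner_self_eq_ofReal_norm_sq] at h2
      exact Complex.ofReal_injective (h2.trans (by push_cast; rfl))
    have h3 : A.singularValues n ^ 2 * ‖v‖ ^ 2 ≤ c ^ 2 * ‖v‖ ^ 2 := by
      rw [← h1, ← mul_pow]
      exact pow_le_pow_left₀ (norm_nonneg _) (h v) 2
    exact le_of_sq_le_sq (le_of_mul_le_mul_right h3 (by positivity)) hc
  -- Beyond the dimension of the domain, singular values are zero by convention.
  · rw [A.singularValues_of_finrank_le (not_lt.1 hn)]
    exact hc

end SingularValues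

theorem norm_toEuclideanLin_apply_le {m n : Type*} [Fintype m] [Fintype n] [DecidableEq n]
    (A : Matrix m n ℂ) {B : ℝ} (hB : ∀ i j, ‖A i j‖ ≤ B) (x : EuclideanSpace ℂ n) :
    ‖Matrix.toEuclideanLin A x‖ ≤ Fintype.card m * (Fintype.card n * B) * ‖x‖ := by
  have h1 : ∀ i, ‖(Matrix.toEuclideanLin A x) i‖ ≤ Fintype.card n * B * ‖x‖ := by
    intro i
    change ‖∑ j, A i j * x j‖ ≤ _
    calc ‖∑ j, A i j * x j‖ ≤ ∑ j, ‖A i j * x j‖ := norm_sum_le _ _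
      _ ≤ ∑ _j : n, B * ‖x‖ := by
        refine Finset.sum_le_sum fun j _ => ?_
        rw [norm_mul]
        exact mul_le_mul (hB i j) (PiLp.norm_apply_le x j) (norm_nonneg _)
          ((norm_nonneg _).trans (hB i j))
      _ = _ := by rw [Finset.sum_const, Finset.card_univ, nsmul_eq_mul]; ring
  calc ‖Matrix.toEuclideanLin A x‖
      = ‖∑ i, (Matrix.toEuclideanLin A x) i • EuclideanSpace.basisFun m ℂ i‖ := by
        conv_lhs => rw [← (EuclideanSpace.basisFun m ℂ).sum_repr (Matrix.toEuclideanLin A x)]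
        simp
    _ ≤ ∑ i, ‖(Matrix.toEuclideanLin A x) i • EuclideanSpace.basisFun m ℂ i‖ := norm_sum_le _ _
    _ ≤ ∑ _i : m, Fintype.card n * B * ‖x‖ := by
        refine Finset.sum_le_sum fun i _ => ?_
        rw [norm_smul, OrthonormalBasis.norm_eq_one, mul_one]
        exact h1 i
    _ = _ := by rw [Finset.sum_const, Finset.card_univ, nsmul_eq_mul]; ring

/-! ### Gains of the channel -/

namespace Channel

variable {Mr Mt L : ℕ} (C : Channel Mr Mt L)

theorem norm_steer (x : ℝ) : ‖C.steer x‖ = 1 := by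
  rw [steer, mul_comm, Complex.norm_exp_ofReal_mul_I]

theorem norm_arrayResponse (N : ℕ) (x : ℝ) (p : Fin N) :
    ‖C.arrayResponse N x p‖ = 1 / √N := by
  rw [arrayResponse, norm_mul, norm_pow, norm_steer, one_pow, mul_one, Complex.norm_real,
    Real.norm_of_nonneg (by positivity)]

theorem norm_arrayResponse_le_one (N : ℕ) (x : ℝ) (p : Fin N) :
    ‖C.arrayResponse N x p‖ ≤ 1 := by
  rw [norm_arrayResponse, div_le_one (Real.sqrt_pos.2 (by exact_mod_cast p.pos)),
    Real.one_le_sqrt]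
  exact_mod_cast p.pos

/-- The inner product of the array responses for the angles `x` and `y`. -/
noncomputable def correlation (N : ℕ) (x y : ℝ) : ℂ :=
  ∑ p : Fin N, conj (C.arrayResponse N x p) * C.arrayResponse N y p

theorem correlation_eq (N : ℕ) (x y : ℝ) :
    C.correlation N x y =
      (N : ℂ)⁻¹ * ∑ p ∈ Finset.range N, (conj (C.steer x) * C.steer y) ^ p := by
  rw [correlation, ← Fin.sum_univ_eq_sum_range fun p => (conj (C.steer x) * C.steer y) ^ p,
    Finset.mul_sum]
  refine Finset.sum_congr rfl fun p _ => ?_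
  have h : (((1 / √N : ℝ) : ℂ)) * ((1 / √N : ℝ) : ℂ) = (N : ℂ)⁻¹ := by
    rw [← Complex.ofReal_mul, div_mul_div_comm, Real.mul_self_sqrt (by positivity)]
    simp
  rw [arrayResponse, arrayResponse, map_mul, Complex.conj_ofReal, map_pow, mul_mul_mul_comm, h,
    mul_pow]

theorem conj_steer_mul_steer_eq_one_iff (x y : ℝ) :
    conj (C.steer x) * C.steer y = 1 ↔ C.steer x = C.steer y := by
  have h : conj (C.steer x) * C.steer x = 1 := by
    rw [Complex.conj_mul', norm_steer]; simp
  constructor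
  · intro h'
    exact mul_left_cancel₀ (left_ne_zero_of_mul_eq_one h) (h.trans h'.symm)
  · intro h'
    rw [← h', h]

theorem correlation_self {N : ℕ} (hN : 0 < N) (x : ℝ) : C.correlation N x x = 1 := by
  have : (N : ℂ) ≠ 0 := by exact_mod_cast hN.ne'
  rw [correlation_eq, (C.conj_steer_mul_steer_eq_one_iff x x).2 rfl]
  simp [this]

theorem norm_correlation_le_one (N : ℕ) (x y : ℝ) : ‖C.correlation N x y‖ ≤ 1 := by
  rw [correlation_eq, norm_mul, norm_inv, Complex.norm_natCast]
  have : ‖∑ p ∈ Finset.range N, (conj (C.steer x) * C.steer y) ^ p‖ ≤ N := by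
    refine (norm_sum_le _ _).trans ?_
    simp [norm_steer]
  exact inv_mul_le_one_of_le₀ this (by positivity)

/-- The correlation is 1/N times a geometric sum whose ratio z has modulus 1 and is not 1, hence is
at most 2/(N‖z-1‖). -/
theorem tendsto_correlation {x y : ℝ} (h : C.steer x ≠ C.steer y) :
    Tendsto (fun N => ‖C.correlation N x y‖) atTop (𝓝 0) := by
  have hz : conj (C.steer x) * C.steer y - 1 ≠ 0 :=
    sub_ne_zero.2 fun h' => h ((C.conj_steer_mul_steer_eq_one_iff x y).1 h')
  have hlim : Tendsto (fun N : ℕ => (N : ℝ)⁻¹ * (2 / ‖conj (C.steer x) * C.steer y - 1‖)) atTop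
      (𝓝 0) := by
    simpa using tendsto_inv_atTop_nhds_zero_nat.mul_const (2 / ‖conj (C.steer x) * C.steer y - 1‖)
  refine squeeze_zero (fun _ => norm_nonneg _) (fun N => ?_) hlim
  rw [correlation_eq, norm_mul, norm_inv, Complex.norm_natCast, geom_sum_eq (sub_ne_zero.1 hz),
    norm_div]
  gcongr
  refine (norm_sub_le _ _).trans ?_
  norm_num [norm_steer]

theorem eventually_norm_correlation_le {ε : ℝ} (hε : 0 < ε) :
    ∃ N₀ : ℕ, ∀ N, N₀ ≤ N → ∀ i j l l',
      (C.steer (C.theta i j l) ≠ C.steer (C.theta i j l') →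
        ‖C.correlation N (C.theta i j l) (C.theta i j l')‖ ≤ ε) ∧
      (C.steer (C.phi i j l) ≠ C.steer (C.phi i j l') →
        ‖C.correlation N (C.phi i j l) (C.phi i j l')‖ ≤ ε) := by
  refine eventually_atTop.1 ?_
  simp only [eventually_all, eventually_and]
  refine fun i j l l' => ⟨fun h => ?_, fun h => ?_⟩ <;>
  exact (C.tendsto_correlation h).eventually_le_const hε

/-- The factor of the gain of a path that is due to its delay. -/
noncomputable def delayPhase {K : ℕ} (k : Fin K) (i : Fin Mr) (j : Fin Mt) (l : Fin L) : ℂ :=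
  Complex.exp (-(Complex.I *
    ((2 * Real.pi * (((k : ℕ) + 1 : ℝ) / K) * (C.tau i j l / C.Ts) : ℝ) : ℂ)))

theorem norm_delayPhase {K : ℕ} (k : Fin K) (i : Fin Mr) (j : Fin Mt) (l : Fin L) :
    ‖C.delayPhase k i j l‖ = 1 := by
  rw [delayPhase, mul_comm, ← neg_mul, ← Complex.ofReal_neg, Complex.norm_exp_ofReal_mul_I]

theorem matrix_apply (Nr Nt : ℕ) {K : ℕ} (α : Fin Mr × Fin Mt × Fin L → ℂ) (k : Fin K)
    (r : Fin Mr × Fin Nr) (c : Fin Mt × Fin Nt) :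
    C.matrix Nr Nt α k r c = ((√(C.beta * ((Nr : ℝ) * Nt / L)) : ℝ) : ℂ) *
      ∑ l : Fin L, α (r.1, c.1, l) * C.arrayResponse Nr (C.theta r.1 c.1 l) r.2 *
        conj (C.arrayResponse Nt (C.phi r.1 c.1 l) c.2) * C.delayPhase k r.1 c.1 l := rfl

theorem norm_matrix_apply_le (Nr Nt : ℕ) {K : ℕ} (α : Fin Mr × Fin Mt × Fin L → ℂ) {ρ : ℝ}
    (hα : ∀ a, ‖α a‖ ≤ ρ) (k : Fin K) (r : Fin Mr × Fin Nr) (c : Fin Mt × Fin Nt) :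
    ‖C.matrix Nr Nt α k r c‖ ≤ √(C.beta * ((Nr : ℝ) * Nt / L)) * (L * ρ) := by
  rw [matrix_apply, norm_mul, Complex.norm_real, Real.norm_of_nonneg (Real.sqrt_nonneg _)]
  gcongr
  refine (norm_sum_le _ _).trans ?_
  calc _ ≤ ∑ _l : Fin L, ρ := by
        refine Finset.sum_le_sum fun l _ => ?_
        rw [norm_mul, norm_mul, norm_mul, norm_delayPhase, mul_one, RCLike.norm_conj]
        have h1 := C.norm_arrayResponse_le_one Nr (C.theta r.1 c.1 l) r.2
        have h2 := C.norm_arrayResponse_le_one Nt (C.phi r.1 c.1 l) c.2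
        calc _ ≤ ‖α (r.1, c.1, l)‖ * 1 * 1 := by gcongr
          _ ≤ ρ := by simpa using hα _
    _ = _ := by simp

/-- A crude entrywise estimate is enough: the lower bound on the error rate needs only linearity in
the size of the path gains, for fixed antenna numbers. -/
theorem exists_gain_le (Nr Nt : ℕ) :
    ∃ B : ℝ, 0 ≤ B ∧ ∀ {K Ns : ℕ} (α : Fin Mr × Fin Mt × Fin L → ℂ) (ρ : ℝ), 0 ≤ ρ →
      (∀ a, ‖α a‖ ≤ ρ) → ∀ (k : Fin K) (s : Fin Ns), C.gain Nr Nt α k s ≤ B * ρ := by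
  refine ⟨Fintype.card (Fin Mr × Fin Nr) * (Fintype.card (Fin Mt × Fin Nt) *
    (√(C.beta * ((Nr : ℝ) * Nt / L)) * L)), by positivity, fun α ρ hρ hα k s => ?_⟩
  refine singularValues_le_of_norm_apply_le _ (by positivity) (fun x => ?_) s
  refine (norm_toEuclideanLin_apply_le _ (C.norm_matrix_apply_le Nr Nt α hα k) x).trans_eq ?_
  ring

theorem gain_nonneg (Nr Nt : ℕ) {K Ns : ℕ} (α : Fin Mr × Fin Mt × Fin L → ℂ) (k : Fin K)
    (s : Fin Ns) : 0 ≤ C.gain Nr Nt α k s :=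
  LinearMap.singularValues_nonneg _ _

/-- The array response for the angle `x` at unit `i`, extended by zero to all units. -/
noncomputable def blockResponse {M : ℕ} (N : ℕ) (i : Fin M) (x : ℝ) :
    EuclideanSpace ℂ (Fin M × Fin N) :=
  WithLp.toLp 2 fun p => if p.1 = i then C.arrayResponse N x p.2 else 0

theorem sum_blockResponse {M N : ℕ} (i : Fin M) (x : ℝ) (f : Fin M × Fin N → ℂ → ℂ)
    (hf : ∀ p, f p 0 = 0) :
    ∑ p, f p (C.blockResponse N i x p) = ∑ p, f (i, p) (C.arrayResponse N x p) := by
  rw [Fintype.sum_prod_type, Finset.sum_eq_single i]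
  · simp [blockResponse]
  · intro i' _ hi'
    simp [blockResponse, hi', hf]
  · simp

theorem norm_blockResponse {M N : ℕ} (hN : 0 < N) (i : Fin M) (x : ℝ) :
    ‖C.blockResponse N i x‖ = 1 := by
  have h : inner ℂ (C.blockResponse N i x) (C.blockResponse N i x) = (1 : ℂ) := by
    rw [PiLp.inner_apply]
    simp only [RCLike.inner_apply']
    rw [C.sum_blockResponse i x (fun p z => conj z * z) (by simp)]
    exact C.correlation_self hN x
  rw [inner_self_eq_ofReal_norm_sq] at h
  have h' : ‖C.blockResponse N i x‖ ^ 2 = 1 := by exact_mod_cast h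
  exact (pow_eq_one_iff_of_nonneg (norm_nonneg _) two_ne_zero).1 h'

theorem inner_blockResponse_matrix (Nr Nt : ℕ) {K : ℕ} (α : Fin Mr × Fin Mt × Fin L → ℂ)
    (k : Fin K) (i : Fin Mr) (j : Fin Mt) (x y : ℝ) :
    inner ℂ (C.blockResponse Nr i x)
        (Matrix.toEuclideanLin (C.matrix Nr Nt α k) (C.blockResponse Nt j y)) =
      ((√(C.beta * ((Nr : ℝ) * Nt / L)) : ℝ) : ℂ) *
        ∑ l, α (i, j, l) * C.delayPhase k i j l * C.correlation Nr x (C.theta i j l) *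
          C.correlation Nt (C.phi i j l) y := by
  have h1 : ∀ r, (Matrix.toEuclideanLin (C.matrix Nr Nt α k) (C.blockResponse Nt j y)) r =
      ∑ q, C.matrix Nr Nt α k r (j, q) * C.arrayResponse Nt y q := by
    intro r
    exact C.sum_blockResponse j y (fun p z => C.matrix Nr Nt α k r p * z) (by simp)
  rw [PiLp.inner_apply]
  simp only [RCLike.inner_apply', h1]
  rw [C.sum_blockResponse i x (fun p z => conj z *
    ∑ q, C.matrix Nr Nt α k p (j, q) * C.arrayResponse Nt y q) (by simp)]
  simp only [matrix_apply, correlation, Finset.mul_sum, Finset.sum_mul]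
  refine Finset.sum_comm.trans ((Finset.sum_congr rfl fun q _ => Finset.sum_comm).trans
    (Finset.sum_comm.trans ?_))
  refine Finset.sum_congr rfl fun l _ => Finset.sum_congr rfl fun q _ =>
    Finset.sum_congr rfl fun p _ => ?_
  ring

/-- Test the matrix on the unit block responses at the angles of the strongest path. That path
contributes its full gain. Any other path of the same pair of units differs from it in the receive
or the transmit steering factor, so one correlation is at most 1/(2L) and the other at most 1.
Together these paths cancel at most half of the main term. -/
theorem le_gain_of_max {Nr Nt : ℕ} (hNr : 0 < Nr) (hNt : 0 < Nt) (hL : 0 < L) (hC : C.PathsDistinct)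
    (h : ∀ i j l l',
      (C.steer (C.theta i j l) ≠ C.steer (C.theta i j l') →
        ‖C.correlation Nr (C.theta i j l) (C.theta i j l')‖ ≤ 1 / (2 * L)) ∧
      (C.steer (C.phi i j l) ≠ C.steer (C.phi i j l') →
        ‖C.correlation Nt (C.phi i j l) (C.phi i j l')‖ ≤ 1 / (2 * L)))
    {K Ns : ℕ} (α : Fin Mr × Fin Mt × Fin L → ℂ) (a : Fin Mr × Fin Mt × Fin L)
    (ha : ∀ b, ‖α b‖ ≤ ‖α a‖) (k : Fin K) (s : Fin Ns) (hs : (s : ℕ) = 0) :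
    √(C.beta * ((Nr : ℝ) * Nt / L)) * (‖α a‖ / 2) ≤ C.gain Nr Nt α k s := by
  obtain ⟨i, j, l⟩ := a
  set x := C.theta i j l
  set y := C.phi i j l
  have h1 : ‖inner ℂ (C.blockResponse Nr i x)
      (Matrix.toEuclideanLin (C.matrix Nr Nt α k) (C.blockResponse Nt j y))‖ ≤
      C.gain Nr Nt α k s := by
    refine (norm_inner_le_norm _ _).trans ?_
    rw [C.norm_blockResponse hNr, one_mul]
    refine (norm_apply_le_singularValues_zero_mul _ _).trans_eq ?_
    rw [C.norm_blockResponse hNt, mul_one, gain, hs]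
  refine le_trans ?_ h1
  rw [inner_blockResponse_matrix, norm_mul, Complex.norm_real,
    Real.norm_of_nonneg (Real.sqrt_nonneg _)]
  gcongr
  rw [← Finset.add_sum_erase _ _ (Finset.mem_univ l), C.correlation_self hNr,
    C.correlation_self hNt, mul_one, mul_one]
  have h2 : ‖∑ l' ∈ Finset.univ.erase l, α (i, j, l') * C.delayPhase k i j l' *
      C.correlation Nr x (C.theta i j l') * C.correlation Nt (C.phi i j l') y‖ ≤
      ‖α (i, j, l)‖ / 2 := by
    refine (norm_sum_le _ _).trans ?_
    calc _ ≤ ∑ _l' ∈ Finset.univ.erase l, ‖α (i, j, l)‖ * (1 / (2 * L)) := by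
          refine Finset.sum_le_sum fun l' hl' => ?_
          rw [norm_mul, norm_mul, norm_mul, norm_delayPhase, mul_one, mul_assoc]
          refine mul_le_mul (ha _) ?_ (by positivity) (norm_nonneg _)
          have hr := C.norm_correlation_le_one Nr x (C.theta i j l')
          have ht := C.norm_correlation_le_one Nt (C.phi i j l') y
          by_cases hx : C.steer (C.theta i j l) = C.steer (C.theta i j l')
          · have hy : C.steer (C.phi i j l') ≠ C.steer (C.phi i j l) := fun hy =>
              (Finset.ne_of_mem_erase hl') (hC i j (Prod.ext hx.symm hy))
            exact (mul_le_of_le_one_left (norm_nonneg _) hr).trans ((h i j l' l).2 hy)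
          · exact (mul_le_of_le_one_right (norm_nonneg _) ht).trans ((h i j l l').1 hx)
      _ ≤ ∑ _l' : Fin L, ‖α (i, j, l)‖ * (1 / (2 * L)) :=
          Finset.sum_le_sum_of_subset_of_nonneg (Finset.erase_subset _ _)
            fun _ _ _ => by positivity
      _ = _ := by
          have : (L : ℝ) ≠ 0 := by positivity
          rw [Finset.sum_const, Finset.card_univ, Fintype.card_fin, nsmul_eq_mul]
          field_simp
  have h3 := norm_sub_norm_le (α (i, j, l) * C.delayPhase k i j l)
    (-∑ l' ∈ Finset.univ.erase l, α (i, j, l') * C.delayPhase k i j l' *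
      C.correlation Nr x (C.theta i j l') * C.correlation Nt (C.phi i j l') y)
  rw [norm_neg, sub_neg_eq_add, norm_mul, norm_delayPhase, mul_one] at h3
  linarith

/-- With enough antennas, the squared gain of the first stream is at least a constant times `Nr Nt`
times the squared norm of the vector of path gains. -/
theorem exists_le_sq_gain (hMr : 0 < Mr) (hMt : 0 < Mt) (hL : 0 < L) (hC : C.PathsDistinct) :
    ∃ N₀ : ℕ, ∃ c : ℝ, 0 < N₀ ∧ 0 < c ∧ ∀ Nr Nt : ℕ, N₀ ≤ Nr → N₀ ≤ Nt →
      ∀ {K Ns : ℕ} (α : Fin Mr × Fin Mt × Fin L → ℂ) (k : Fin K) (s : Fin Ns), (s : ℕ) = 0 →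
        c * (Nr * Nt) * ∑ a, ‖α a‖ ^ 2 ≤ C.gain Nr Nt α k s ^ 2 := by
  have hL' : (0 : ℝ) < L := by exact_mod_cast hL
  obtain ⟨N₁, hN₁⟩ := C.eventually_norm_correlation_le (ε := 1 / (2 * L)) (by positivity)
  have hβ := C.beta_pos
  have hD : 0 < Fintype.card (Fin Mr × Fin Mt × Fin L) := by simp [hMr, hMt, hL]
  -- The 4 is the square of the half lost to the other paths; the cardinality is the price of
  -- replacing the largest squared path gain by their sum. Adding 1 makes the arrays nonempty.
  refine ⟨N₁ + 1, C.beta / (4 * L * Fintype.card (Fin Mr × Fin Mt × Fin L)), by omega,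
    by positivity, fun Nr Nt hNr hNt K Ns α k s hs => ?_⟩
  have : Nonempty (Fin Mr × Fin Mt × Fin L) := Fintype.card_pos_iff.1 hD
  obtain ⟨a, ha⟩ := Finite.exists_max fun b => ‖α b‖
  have h := C.le_gain_of_max (by omega) (by omega) hL hC (fun i j l l' =>
    ⟨(hN₁ Nr (by omega) i j l l').1, (hN₁ Nt (by omega) i j l l').2⟩) α a ha k s hs
  refine le_trans ?_ (pow_le_pow_left₀ (by positivity) h 2)
  rw [mul_pow, Real.sq_sqrt (by positivity), div_pow]
  have hsum : ∑ b, ‖α b‖ ^ 2 ≤ Fintype.card (Fin Mr × Fin Mt × Fin L) * ‖α a‖ ^ 2 := by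
    rw [← nsmul_eq_mul, ← Finset.card_univ]
    exact Finset.sum_le_card_nsmul _ _ _ fun b _ => pow_le_pow_left₀ (norm_nonneg _) (ha b) 2
  calc _ ≤ C.beta / (4 * L * Fintype.card (Fin Mr × Fin Mt × Fin L)) * (Nr * Nt) *
      (Fintype.card (Fin Mr × Fin Mt × Fin L) * ‖α a‖ ^ 2) := by gcongr
    _ = _ := by field_simp; ring

end Channel

/-! ### Decoding errors for given gains -/

theorem bitErrors_self {T kc : ℕ} (u : Message T kc) : bitErrors u u = 0 := by
  simp [bitErrors]

theorem bitErrors_pos {T kc : ℕ} {u v : Message T kc} (h : u ≠ v) : 1 ≤ bitErrors u v := by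
  rw [bitErrors, Nat.one_le_iff_ne_zero, Finset.card_ne_zero]
  by_contra hne
  refine h (funext fun t => funext fun i => ?_)
  by_contra hti
  exact hne ⟨(t, i), by simpa using hti⟩

theorem bitErrors_le {T kc : ℕ} (u v : Message T kc) : bitErrors u v ≤ T * kc :=
  (Finset.card_filter_le _ _).trans_eq (by simp)

theorem bitErrors_div_le_one {T kc : ℕ} (u v : Message T kc) :
    (bitErrors u v : ℝ≥0∞) / (T * kc : ℕ) ≤ 1 :=
  ENNReal.div_le_of_le_mul (by rw [one_mul]; exact_mod_cast bitErrors_le u v)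

theorem exists_pos_le_norm_sub {ι : Type*} [Finite ι] {χ : ι → ℂ} (hχ : Function.Injective χ) :
    ∃ δ : ℝ, 0 < δ ∧ ∀ a b, a ≠ b → δ ≤ ‖χ a - χ b‖ := by
  rcases isEmpty_or_nonempty {p : ι × ι // p.1 ≠ p.2} with h | h
  · exact ⟨1, one_pos, fun a b hab => (h.false ⟨(a, b), hab⟩).elim⟩
  · obtain ⟨p, hp⟩ := Finite.exists_min
      fun p : {p : ι × ι // p.1 ≠ p.2} => ‖χ p.1.1 - χ p.1.2‖
    exact ⟨_, norm_pos_iff.2 (sub_ne_zero.2 fun h => p.2 (hχ h)), fun a b hab => hp ⟨(a, b), hab⟩⟩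

section System

variable {kc nc ν T K Ns m : ℕ}

theorem bitMetric_nonneg (χ : (Fin m → ZMod 2) → ℂ) (y : ℂ) (σ : ℝ) (i : Fin m) (b : ZMod 2) :
    0 ≤ bitMetric χ y σ i b :=
  Real.iInf_nonneg fun _ => by positivity

theorem bitMetric_le (χ : (Fin m → ZMod 2) → ℂ) (y : ℂ) (σ : ℝ) (i : Fin m)
    (a : Fin m → ZMod 2) : bitMetric χ y σ i (a i) ≤ ‖y - σ * χ a‖ ^ 2 :=
  ciInf_le (f := fun a' : {a' : Fin m → ZMod 2 // a' i = a i} => ‖y - σ * χ a'‖ ^ 2)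
    ⟨0, by rintro _ ⟨_, rfl⟩; positivity⟩ ⟨a, rfl⟩

theorem le_bitMetric (χ : (Fin m → ZMod 2) → ℂ) (y : ℂ) (σ : ℝ) (i : Fin m) (b : ZMod 2) {x : ℝ}
    (h : ∀ a, a i = b → x ≤ ‖y - σ * χ a‖ ^ 2) : x ≤ bitMetric χ y σ i b :=
  have : Nonempty {a : Fin m → ZMod 2 // a i = b} := ⟨fun _ => b, rfl⟩
  le_ciInf fun a => h a.1 a.2

/-- If the decoder errs, then the noise on some subcarrier and some stream is at least proportional
to the smallest gain of any given stream. -/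
theorem exists_noise_of_error (g : ConvEncoder kc nc ν)
    (hg : Function.Injective (codeword g : Message T kc → Fin ((T + ν) * nc) → ZMod 2))
    {χ : (Fin m → ZMod 2) → ℂ} (hχ : Function.Injective χ)
    {π : Interleaver ((T + ν) * nc) K Ns m} (hπ : DesignCriteria g π) :
    ∃ η : ℝ, 0 < η ∧ ∀ {dec : Decoder K Ns T kc}, IsMLDecoder g χ π dec →
      ∀ (σ : Fin K → Fin Ns → ℝ) (s₀ : Fin Ns) (σ₀ : ℝ), 0 ≤ σ₀ → (∀ k, σ₀ ≤ σ k s₀) →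
      ∀ (n : Fin K → Fin Ns → ℂ) (u : Message T kc),
        dec (fun k s => σ k s * symbol g χ π u k s + n k s) σ ≠ u →
        ∃ k s, η * σ₀ ≤ ‖n k s‖ := by
  obtain ⟨δ, hδ, hδχ⟩ := exists_pos_le_norm_sub hχ
  set M : ℝ := (((T + ν) * nc : ℕ) : ℝ)
  have hM : 0 ≤ M := Nat.cast_nonneg _
  -- With all noise below ρ = ησ₀, the sent codeword has total metric at most Mρ². A bit on stream
  -- s₀ in which the decoded codeword v differs alone costs v at least ((2+M)ρ - ρ)² = (1+M)²ρ²,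
  -- which exceeds Mρ².
  refine ⟨δ / (2 + M), by positivity, fun {dec} hdec σ s₀ σ₀ hσ₀ hσ n u hu => ?_⟩
  by_contra! hn
  set ρ := δ / (2 + M) * σ₀ with hρ
  set y : Fin K → Fin Ns → ℂ := fun k s => σ k s * symbol g χ π u k s + n k s
  set v := dec y σ
  have hmin : codeMetric g χ π y σ v ≤ codeMetric g χ π y σ u := hdec.isMin y σ u
  obtain ⟨q₀, hq₀, hs₀⟩ := hπ.uses_all_subchannels v u (fun h => hu (hg h)) s₀
  -- σ₀ may be zero a priori; positivity comes from the strict noise bound being refuted.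
  have hρ0 : 0 < ρ := (norm_nonneg _).trans_lt (hn (π q₀).1 (π q₀).2.1)
  have hsym : ∀ q, y (π q).1 (π q).2.1 - σ (π q).1 (π q).2.1 *
      χ (fun i => codeword g u (π.symm ((π q).1, (π q).2.1, i))) = n (π q).1 (π q).2.1 :=
    fun q => add_sub_cancel_left _ _
  have hlabel : ∀ q, codeword g u (π.symm ((π q).1, (π q).2.1, (π q).2.2)) = codeword g u q :=
    fun q => congrArg _ (π.symm_apply_apply q)
  have hU : ∀ q, bitMetric χ (y (π q).1 (π q).2.1) (σ (π q).1 (π q).2.1) (π q).2.2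
      (codeword g u q) ≤ ρ ^ 2 := by
    intro q
    have h := bitMetric_le χ (y (π q).1 (π q).2.1) (σ (π q).1 (π q).2.1) (π q).2.2
      (fun i => codeword g u (π.symm ((π q).1, (π q).2.1, i)))
    rw [hsym] at h
    simp only [hlabel] at h
    exact h.trans (pow_le_pow_left₀ (norm_nonneg _) (hn _ _).le 2)
  have hV : ((1 + M) * ρ) ^ 2 ≤ bitMetric χ (y (π q₀).1 (π q₀).2.1) (σ (π q₀).1 (π q₀).2.1)
      (π q₀).2.2 (codeword g v q₀) := by
    refine le_bitMetric _ _ _ _ _ fun a ha => pow_le_pow_left₀ (by positivity) ?_ 2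
    set b : Fin m → ZMod 2 := fun i => codeword g u (π.symm ((π q₀).1, (π q₀).2.1, i))
    have hab : b ≠ a := by
      intro hab
      refine hq₀ (ha.symm.trans ?_)
      rw [← hab]
      exact hlabel q₀
    have h1 : y (π q₀).1 (π q₀).2.1 - σ (π q₀).1 (π q₀).2.1 * χ a =
        σ (π q₀).1 (π q₀).2.1 * (χ b - χ a) + n (π q₀).1 (π q₀).2.1 := by
      rw [← hsym q₀]; ring
    have hσq : σ₀ ≤ σ (π q₀).1 (π q₀).2.1 := hs₀ ▸ hσ _
    have h2 : σ₀ * δ ≤ ‖(σ (π q₀).1 (π q₀).2.1 : ℂ) * (χ b - χ a)‖ := by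
      rw [norm_mul, Complex.norm_real, Real.norm_of_nonneg (hσ₀.trans hσq)]
      exact mul_le_mul hσq (hδχ b a hab) hδ.le (hσ₀.trans hσq)
    have h3 := norm_sub_le_norm_add ((σ (π q₀).1 (π q₀).2.1 : ℂ) * (χ b - χ a))
      (n (π q₀).1 (π q₀).2.1)
    have h4 := hn (π q₀).1 (π q₀).2.1
    have h5 : σ₀ * δ = (2 + M) * ρ := by rw [hρ]; field_simp
    rw [h1]
    linarith
  set d : Fin ((T + ν) * nc) → ℝ := fun q =>
    bitMetric χ (y (π q).1 (π q).2.1) (σ (π q).1 (π q).2.1) (π q).2.2 (codeword g v q) -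
      bitMetric χ (y (π q).1 (π q).2.1) (σ (π q).1 (π q).2.1) (π q).2.2 (codeword g u q)
  have hd : ∑ q, d q ≤ 0 := by
    rw [Finset.sum_sub_distrib]
    exact sub_nonpos.2 hmin
  -- Adding ρ² makes every summand nonnegative, so the single term at q₀ is bounded by the whole
  -- sum.
  have hd0 : d q₀ + ρ ^ 2 ≤ ∑ q, (d q + ρ ^ 2) := by
    refine Finset.single_le_sum (f := fun q => d q + ρ ^ 2) (fun q _ => ?_) (Finset.mem_univ q₀)
    have := hU q
    have := bitMetric_nonneg χ (y (π q).1 (π q).2.1) (σ (π q).1 (π q).2.1) (π q).2.2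
      (codeword g v q)
    simp only [d]
    linarith
  have hsum : ∑ q, (d q + ρ ^ 2) = ∑ q, d q + M * ρ ^ 2 := by
    rw [Finset.sum_add_distrib, Finset.sum_const, Finset.card_univ, Fintype.card_fin, nsmul_eq_mul]
  have hq := hU q₀
  have hρ2 : 0 < ρ ^ 2 := by positivity
  simp only [d] at hd0 hd hsum
  nlinarith [mul_nonneg hM hρ2.le, mul_nonneg (mul_nonneg hM hM) hρ2.le]

theorem conditionalBER_le_one (g : ConvEncoder kc nc ν) (χ : (Fin m → ZMod 2) → ℂ)
    (π : Interleaver ((T + ν) * nc) K Ns m) (dec : Decoder K Ns T kc)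
    (σ : Fin K → Fin Ns → ℝ) (N₀ : ℝ≥0) : conditionalBER g χ π dec σ N₀ ≤ 1 := by
  rw [conditionalBER]
  calc _ ≤ (Fintype.card (Message T kc) : ℝ≥0∞)⁻¹ * ∑ _u : Message T kc, 1 := by
        gcongr with u
        refine (lintegral_mono fun n => bitErrors_div_le_one u _).trans_eq ?_
        simp
    _ = 1 := by
        rw [Finset.sum_const, Finset.card_univ, nsmul_eq_mul, mul_one]
        exact ENNReal.inv_mul_cancel (by simp) (by simp)

/-- The Chernoff parameter 1/(2N₀) is half the critical value 1/N₀, so the exponential moment is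
finite, equal to 2. -/
theorem lintegral_noise_exp {N₀ : ℝ≥0} (hN₀ : N₀ ≠ 0) (x : ℝ) (k : Fin K) (s : Fin Ns) :
    ∫⁻ n : Fin K → Fin Ns → ℂ,
      ENNReal.ofReal (Real.exp ((‖n k s‖ ^ 2 - x) / (2 * N₀)))
      ∂(Measure.pi fun _ => Measure.pi fun _ => complexGaussian N₀) =
      ENNReal.ofReal (2 * Real.exp (-x / (2 * N₀))) := by
  have hN : (0 : ℝ) < N₀ := by positivity
  have h1 := (measurePreserving_eval (fun _ : Fin K => Measure.pi fun _ : Fin Ns =>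
    complexGaussian N₀) k).lintegral_comp (f := fun z : Fin Ns → ℂ =>
      ENNReal.ofReal (Real.exp ((‖z s‖ ^ 2 - x) / (2 * N₀)))) (by fun_prop)
  have h2 := (measurePreserving_eval (fun _ : Fin Ns => complexGaussian N₀) s).lintegral_comp
    (f := fun z : ℂ => ENNReal.ofReal (Real.exp ((‖z‖ ^ 2 - x) / (2 * N₀)))) (by fun_prop)
  refine h1.trans (h2.trans ?_)
  have h3 : ∀ z : ℂ, ENNReal.ofReal (Real.exp ((‖z‖ ^ 2 - x) / (2 * N₀))) =
      ENNReal.ofReal (Real.exp (-x / (2 * N₀))) *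
        ENNReal.ofReal (Real.exp (-(-(1 / (2 * (N₀ : ℝ)))) * ‖z‖ ^ 2)) := by
    intro z
    rw [← ENNReal.ofReal_mul (by positivity), ← Real.exp_add]
    congr 2
    field_simp
    ring
  have h4 : 1 + -(1 / (2 * (N₀ : ℝ))) * N₀ = 1 / 2 := by field_simp; norm_num
  simp_rw [h3]
  rw [lintegral_const_mul _ (by fun_prop),
    lintegral_exp_neg_mul_normSq_complexGaussian hN₀ (by rw [h4]; norm_num), h4,
    ← ENNReal.ofReal_mul (by positivity)]
  congr 1
  ring

/-- An error makes one of the K·Ns noise samples large; a union bound with the Chernoff estimate for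
each sample finishes. -/
theorem conditionalBER_le (g : ConvEncoder kc nc ν)
    (hg : Function.Injective (codeword g : Message T kc → Fin ((T + ν) * nc) → ZMod 2))
    {χ : (Fin m → ZMod 2) → ℂ} (hχ : Function.Injective χ)
    {π : Interleaver ((T + ν) * nc) K Ns m} (hπ : DesignCriteria g π) :
    ∃ η : ℝ, 0 < η ∧ ∀ {dec : Decoder K Ns T kc}, IsMLDecoder g χ π dec →
      ∀ (σ : Fin K → Fin Ns → ℝ) (s₀ : Fin Ns) (x : ℝ), 0 ≤ x → (∀ k, 0 ≤ σ k s₀) →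
      (∀ k, x ≤ σ k s₀ ^ 2) → ∀ N₀ : ℝ≥0, N₀ ≠ 0 →
      conditionalBER g χ π dec σ N₀ ≤
        ENNReal.ofReal (2 * (K * Ns) * Real.exp (-(η * x / N₀))) := by
  obtain ⟨η, hη, herr⟩ := exists_noise_of_error g hg hχ hπ
  refine ⟨η ^ 2 / 2, by positivity, fun {dec} hdec σ s₀ x hx hσ0 hσ N₀ hN₀ => ?_⟩
  have hN : (0 : ℝ) < N₀ := by positivity
  set X : ℝ≥0∞ := ENNReal.ofReal (2 * (K * Ns) * Real.exp (-(η ^ 2 / 2 * x / N₀)))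
  have hu : ∀ u : Message T kc, ∫⁻ n : Fin K → Fin Ns → ℂ,
      (bitErrors u (dec (fun k s => σ k s * symbol g χ π u k s + n k s) σ) : ℝ≥0∞) / (T * kc : ℕ)
      ∂(Measure.pi fun _ => Measure.pi fun _ => complexGaussian N₀) ≤ X := by
    intro u
    calc _ ≤ ∫⁻ n : Fin K → Fin Ns → ℂ, ∑ k, ∑ s,
          ENNReal.ofReal (Real.exp ((‖n k s‖ ^ 2 - η ^ 2 * x) / (2 * N₀)))
          ∂(Measure.pi fun _ => Measure.pi fun _ => complexGaussian N₀) := by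
          refine lintegral_mono fun n => ?_
          by_cases hd : dec (fun k s => σ k s * symbol g χ π u k s + n k s) σ = u
          · simp only [hd, bitErrors_self, Nat.cast_zero, ENNReal.zero_div]
            exact zero_le
          · obtain ⟨k, s, hks⟩ := herr hdec σ s₀ (√x) (Real.sqrt_nonneg x)
              (fun k => Real.sqrt_le_iff.2 ⟨hσ0 k, hσ k⟩) n u hd
            refine (bitErrors_div_le_one u _).trans ?_
            have h1 : 1 ≤ ENNReal.ofReal (Real.exp ((‖n k s‖ ^ 2 - η ^ 2 * x) / (2 * N₀))) := by
              rw [← ENNReal.ofReal_one]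
              refine ENNReal.ofReal_le_ofReal (Real.one_le_exp (div_nonneg ?_ (by positivity)))
              have := pow_le_pow_left₀ (by positivity) hks 2
              rw [mul_pow, Real.sq_sqrt hx] at this
              linarith
            refine h1.trans (le_trans ?_ (Finset.single_le_sum
              (f := fun k => ∑ s, ENNReal.ofReal
                (Real.exp ((‖n k s‖ ^ 2 - η ^ 2 * x) / (2 * N₀))))
              (fun _ _ => zero_le) (Finset.mem_univ k)))
            exact Finset.single_le_sum
              (f := fun s => ENNReal.ofReal (Real.exp ((‖n k s‖ ^ 2 - η ^ 2 * x) / (2 * N₀))))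
              (fun _ _ => zero_le) (Finset.mem_univ s)
      _ = X := by
          rw [lintegral_finsetSum _ fun k _ => by fun_prop]
          have hk : ∀ k : Fin K, ∫⁻ n : Fin K → Fin Ns → ℂ, ∑ s,
              ENNReal.ofReal (Real.exp ((‖n k s‖ ^ 2 - η ^ 2 * x) / (2 * N₀)))
              ∂(Measure.pi fun _ => Measure.pi fun _ => complexGaussian N₀) =
              ∑ _s : Fin Ns, ENNReal.ofReal (2 * Real.exp (-(η ^ 2 * x) / (2 * N₀))) := by
            intro k
            rw [lintegral_finsetSum _ fun s _ => by fun_prop]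
            exact Finset.sum_congr rfl fun s _ => lintegral_noise_exp hN₀ _ k s
          simp only [hk]
          simp only [Finset.sum_const, Finset.card_univ, Fintype.card_fin, nsmul_eq_mul, X]
          rw [← ENNReal.ofReal_natCast, ← ENNReal.ofReal_natCast,
            ← ENNReal.ofReal_mul (by positivity), ← ENNReal.ofReal_mul (by positivity)]
          congr 1
          have : -(η ^ 2 * x) / (2 * (N₀ : ℝ)) = -(η ^ 2 / 2 * x / N₀) := by field_simp
          rw [this]
          ring
  rw [conditionalBER]
  calc _ ≤ (Fintype.card (Message T kc) : ℝ≥0∞)⁻¹ * ∑ _u : Message T kc, X := by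
        gcongr with u
        exact hu u
    _ = X := by
        rw [Finset.sum_const, Finset.card_univ, nsmul_eq_mul, ← mul_assoc,
          ENNReal.inv_mul_cancel (by simp) (by simp), one_mul]

/-- Two messages suffice. Under either one the received vector's law dominates the same multiple of
one centred Gaussian measure. The two decoding regions are disjoint, so their complements have total
mass at least 1, and each error costs at least one bit. -/
theorem le_conditionalBER (hT : 0 < T) (hkc : 0 < kc) (g : ConvEncoder kc nc ν)
    (χ : (Fin m → ZMod 2) → ℂ) (π : Interleaver ((T + ν) * nc) K Ns m)
    {dec : Decoder K Ns T kc} (hdec : IsMLDecoder g χ π dec)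
    (σ : Fin K → Fin Ns → ℝ) {N₀ : ℝ≥0} (hN₀ : N₀ ≠ 0) {R : ℝ}
    (hR : ∀ k s a, 2 * ‖σ k s * χ a‖ ^ 2 / N₀ ≤ R) :
    (Fintype.card (Message T kc) : ℝ≥0∞)⁻¹ * (((T * kc : ℕ) : ℝ≥0∞)⁻¹ *
      (ENNReal.ofReal (Real.exp (-R) / 2) ^ Ns) ^ K) ≤ conditionalBER g χ π dec σ N₀ := by
  set u : Message T kc := fun _ _ => 0
  set v : Message T kc := fun _ _ => 1
  have huv : u ≠ v := fun h => zero_ne_one (congrFun (congrFun h ⟨0, hT⟩) ⟨0, hkc⟩)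
  set μ : Measure (Fin K → Fin Ns → ℂ) :=
    Measure.pi fun _ => Measure.pi fun _ => complexGaussian N₀
  set μ' : Measure (Fin K → Fin Ns → ℂ) :=
    Measure.pi fun _ => Measure.pi fun _ => complexGaussian (N₀ / 2)
  set κ := (ENNReal.ofReal (Real.exp (-R) / 2) ^ Ns) ^ K
  set f : Message T kc → ℝ≥0∞ := fun w => ∫⁻ n : Fin K → Fin Ns → ℂ,
      (bitErrors w (dec (fun k s => σ k s * symbol g χ π w k s + n k s) σ) : ℝ≥0∞) / (T * kc : ℕ)
      ∂μ
  have hf : ∀ w, ((T * kc : ℕ) : ℝ≥0∞)⁻¹ * (κ * μ' {y | dec y σ = w}ᶜ) ≤ f w := by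
    intro w
    set x : Fin K → Fin Ns → ℂ := fun k s => σ k s * symbol g χ π w k s
    have hA : MeasurableSet {y | dec y σ = w}ᶜ := (hdec.measurable σ w).compl
    have hle := smul_pi_pi_complexGaussian_le_map_add hN₀ (a := x) (R := R)
      fun k s => hR k s _
    have h1 := hle {y | dec y σ = w}ᶜ
    rw [Fintype.card_fin, Fintype.card_fin, Measure.smul_apply, smul_eq_mul,
      Measure.map_apply (by fun_prop) hA] at h1
    calc _ ≤ ((T * kc : ℕ) : ℝ≥0∞)⁻¹ * μ ((x + ·) ⁻¹' {y | dec y σ = w}ᶜ) := by gcongr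
      _ = ∫⁻ n, ((x + ·) ⁻¹' {y | dec y σ = w}ᶜ).indicator
          (fun _ => ((T * kc : ℕ) : ℝ≥0∞)⁻¹) n ∂μ :=
          (lintegral_indicator_const (measurableSet_preimage (by fun_prop) hA) _).symm
      _ ≤ f w := by
          refine lintegral_mono fun n => Set.indicator_apply_le' (fun hn => ?_) fun _ => zero_le
          have hne : w ≠ dec (fun k s => σ k s * symbol g χ π w k s + n k s) σ :=
            fun h => hn h.symm
          rw [← one_div]
          gcongr
          exact_mod_cast bitErrors_pos hne
  have hprob : IsProbabilityMeasure μ' := inferInstance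
  have hsum : ((T * kc : ℕ) : ℝ≥0∞)⁻¹ * κ ≤ f u + f v := by
    refine le_trans ?_ (add_le_add (hf u) (hf v))
    rw [← mul_add, ← mul_add]
    gcongr
    have h1 : (1 : ℝ≥0∞) ≤ μ' {y | dec y σ = u}ᶜ + μ' {y | dec y σ = v}ᶜ := by
      rw [← measure_univ (μ := μ')]
      refine le_trans (measure_mono fun y _ => ?_) (measure_union_le _ _)
      by_cases h : dec y σ = u
      · exact Or.inr fun h' => huv (h.symm.trans h')
      · exact Or.inl h
    exact le_mul_of_one_le_right zero_le h1
  rw [conditionalBER]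
  gcongr
  refine hsum.trans ?_
  rw [← Finset.sum_pair huv]
  exact Finset.sum_le_sum_of_subset (Finset.subset_univ _)

end System

/-! ### Bounds for the bit error rate -/

section System

variable {kc nc ν T K Ns m : ℕ} {Mr Mt L : ℕ}

theorem lintegral_conditionalBER_le_one (C : Channel Mr Mt L) (g : ConvEncoder kc nc ν)
    (χ : (Fin m → ZMod 2) → ℂ) (π : Interleaver ((T + ν) * nc) K Ns m) (dec : Decoder K Ns T kc)
    (Nr Nt : ℕ) (N₀ : ℝ≥0) :
    ∫⁻ α : Fin Mr × Fin Mt × Fin L → ℂ,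
      conditionalBER g χ π dec (fun k s => C.gain Nr Nt α k s) N₀
      ∂(Measure.pi fun _ => complexGaussian 1) ≤ 1 :=
  (lintegral_mono fun _ => conditionalBER_le_one g χ π dec _ N₀).trans_eq (by simp)

theorem bitErrorRate_le_one (C : Channel Mr Mt L) (g : ConvEncoder kc nc ν)
    (χ : (Fin m → ZMod 2) → ℂ) (π : Interleaver ((T + ν) * nc) K Ns m) (dec : Decoder K Ns T kc)
    (Nr Nt : ℕ) (snr : ℝ) : bitErrorRate C g χ π dec Nr Nt snr ≤ 1 :=
  ENNReal.toReal_le_of_le_ofReal zero_le_one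
    ((lintegral_conditionalBER_le_one C g χ π dec Nr Nt _).trans_eq ENNReal.ofReal_one.symm)

theorem card_pos_of_injective_codeword (hT : 0 < T) (hkc : 0 < kc) {g : ConvEncoder kc nc ν}
    (hg : Function.Injective (codeword g : Message T kc → Fin ((T + ν) * nc) → ZMod 2))
    (π : Interleaver ((T + ν) * nc) K Ns m) : 0 < K ∧ 0 < Ns := by
  have huv : (fun _ _ => 0 : Message T kc) ≠ fun _ _ => 1 :=
    fun h => zero_ne_one (congrFun (congrFun h ⟨0, hT⟩) ⟨0, hkc⟩)
  obtain ⟨q, -⟩ := Function.ne_iff.1 (hg.ne huv)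
  exact ⟨(π q).1.pos, (π q).2.1.pos⟩

/-- The squared gain grows like Nr Nt and the noise variance is Nt/SNR, so Nt cancels and the bound
depends on Nr SNR alone. -/
theorem exists_bitErrorRate_le (hMr : 0 < Mr) (hMt : 0 < Mt) (hL : 0 < L) (hT : 0 < T)
    (hkc : 0 < kc) (C : Channel Mr Mt L) (hC : C.PathsDistinct) (g : ConvEncoder kc nc ν)
    (hg : Function.Injective (codeword g : Message T kc → Fin ((T + ν) * nc) → ZMod 2))
    {χ : (Fin m → ZMod 2) → ℂ} (hχ : Function.Injective χ)
    {π : Interleaver ((T + ν) * nc) K Ns m} (hπ : DesignCriteria g π)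
    {dec : Decoder K Ns T kc} (hdec : IsMLDecoder g χ π dec) :
    ∃ N₀ : ℕ, ∃ c : ℝ, 0 < N₀ ∧ 0 < c ∧ ∀ Nr Nt : ℕ, N₀ ≤ Nr → N₀ ≤ Nt → ∀ snr : ℝ, 0 < snr →
      bitErrorRate C g χ π dec Nr Nt snr ≤ c * ((Nr * snr) ^ (Mr * Mt * L))⁻¹ := by
  obtain ⟨N₀, b, hN₀, hb, hgain⟩ := C.exists_le_sq_gain hMr hMt hL hC
  obtain ⟨η, hη, hBER⟩ := conditionalBER_le g hg hχ hπ
  obtain ⟨hK, hNs⟩ := card_pos_of_injective_codeword hT hkc hg π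
  refine ⟨N₀, 2 * (K * Ns) * ((η * b) ^ (Mr * Mt * L))⁻¹, hN₀, by positivity,
    fun Nr Nt hNr hNt snr hsnr => ?_⟩
  have hNr' : (0 : ℝ) < Nr := by exact_mod_cast hN₀.trans_le hNr
  have hNt' : (0 : ℝ) < Nt := by exact_mod_cast hN₀.trans_le hNt
  have hv : Real.toNNReal (Nt / snr) ≠ 0 := (Real.toNNReal_pos.2 (by positivity)).ne'
  set s : ℝ := η * b * (Nr * snr) with hs
  have hs0 : 0 < s := by positivity
  refine ENNReal.toReal_le_of_le_ofReal (by positivity) ?_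
  calc _ ≤ ∫⁻ α : Fin Mr × Fin Mt × Fin L → ℂ, ENNReal.ofReal (2 * (K * Ns)) *
        ENNReal.ofReal (Real.exp (-s * ∑ a, ‖α a‖ ^ 2))
        ∂(Measure.pi fun _ => complexGaussian 1) := by
        refine lintegral_mono fun α => ?_
        refine (hBER hdec _ ⟨0, hNs⟩ (b * (Nr * Nt) * ∑ a, ‖α a‖ ^ 2) (by positivity)
          (fun k => C.gain_nonneg Nr Nt α k _)
          (fun k => hgain Nr Nt hNr hNt α k _ rfl) _ hv).trans_eq ?_
        rw [← ENNReal.ofReal_mul (by positivity), Real.coe_toNNReal _ (by positivity), hs]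
        congr 3
        field_simp
    _ = ENNReal.ofReal (2 * (K * Ns) * (1 + s)⁻¹ ^ (Mr * Mt * L)) := by
        rw [lintegral_const_mul _ (by fun_prop), lintegral_pi_exp_neg_mul_sum hs0.le,
          ← ENNReal.ofReal_mul (by positivity)]
        simp [mul_assoc]
    _ ≤ _ := by
        refine ENNReal.ofReal_le_ofReal ?_
        rw [mul_assoc (2 * ((K : ℝ) * Ns)), ← mul_inv, ← mul_pow, ← hs, ← inv_pow]
        gcongr
        linarith

theorem exists_le_bitErrorRate (hT : 0 < T) (hkc : 0 < kc) (C : Channel Mr Mt L)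
    (g : ConvEncoder kc nc ν) (χ : (Fin m → ZMod 2) → ℂ)
    (π : Interleaver ((T + ν) * nc) K Ns m)
    {dec : Decoder K Ns T kc} (hdec : IsMLDecoder g χ π dec) {Nr Nt : ℕ} (hNt : 0 < Nt) :
    ∃ c : ℝ, 0 < c ∧ ∀ snr : ℝ, 1 ≤ snr →
      c * (snr ^ (Mr * Mt * L))⁻¹ ≤ bitErrorRate C g χ π dec Nr Nt snr := by
  obtain ⟨B, hB, hgain⟩ := C.exists_gain_le Nr Nt
  obtain ⟨b, hb, hball⟩ := exists_le_complexGaussian_ball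
  obtain ⟨a₀, ha₀⟩ := Finite.exists_max fun a => ‖χ a‖
  have hNt' : (0 : ℝ) < Nt := by exact_mod_cast hNt
  -- On the event below, gains are at most 2B·SNR^(-1/2) while the noise variance is Nt/SNR, so SNR
  -- cancels in this signal-to-noise bound.
  set R : ℝ := 2 * (B * 2 * ‖χ a₀‖) ^ 2 / Nt with hR
  set ε : ℝ≥0∞ := (Fintype.card (Message T kc) : ℝ≥0∞)⁻¹ * (((T * kc : ℕ) : ℝ≥0∞)⁻¹ *
      (ENNReal.ofReal (Real.exp (-R) / 2) ^ Ns) ^ K) with hε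
  have hε0 : ε ≠ 0 := by
    refine mul_ne_zero (by simp) (mul_ne_zero (ENNReal.inv_ne_zero.2 (ENNReal.natCast_ne_top _))
      (pow_ne_zero _ (pow_ne_zero _ ?_)))
    exact (ENNReal.ofReal_pos.2 (by positivity)).ne'
  have hεt : ε ≠ ∞ := by
    refine ENNReal.mul_ne_top (by simp) (ENNReal.mul_ne_top (ENNReal.inv_ne_top.2 ?_) ?_)
    · exact_mod_cast (Nat.mul_pos hT hkc).ne'
    · exact ENNReal.pow_ne_top (ENNReal.pow_ne_top ENNReal.ofReal_ne_top)
  refine ⟨ε.toReal * b ^ (Mr * Mt * L), mul_pos (ENNReal.toReal_pos hε0 hεt) (by positivity),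
    fun snr hsnr => ?_⟩
  have hsnr0 : 0 < snr := by linarith
  set N₀ := Real.toNNReal (Nt / snr)
  have hN₀ : N₀ ≠ 0 := (Real.toNNReal_pos.2 (by positivity)).ne'
  set r : ℝ := (√snr)⁻¹
  have hr0 : 0 ≤ r := by positivity
  have hr1 : r ≤ 1 := inv_le_one_of_one_le₀ (Real.one_le_sqrt.2 hsnr)
  have hr2 : r ^ 2 = snr⁻¹ := by rw [inv_pow, Real.sq_sqrt hsnr0.le]
  set S : Set (Fin Mr × Fin Mt × Fin L → ℂ) := Set.univ.pi fun _ => {z | ‖z‖ ≤ 2 * r}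
  have hS : MeasurableSet S :=
    MeasurableSet.univ_pi fun _ => measurableSet_le (by fun_prop) measurable_const
  have hcond : ∀ α ∈ S, ε ≤ conditionalBER g χ π dec (fun k s => C.gain Nr Nt α k s) N₀ := by
    intro α hα
    refine le_conditionalBER hT hkc g χ π hdec _ hN₀ fun k s a => ?_
    have h1 : C.gain Nr Nt α k s ≤ B * (2 * r) :=
      hgain α (2 * r) (by positivity) (fun a => hα a (Set.mem_univ a)) k s
    have h2 := C.gain_nonneg Nr Nt α k s
    rw [norm_mul, Complex.norm_real, Real.norm_of_nonneg h2, Real.coe_toNNReal _ (by positivity)]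
    calc _ ≤ 2 * (B * (2 * r) * ‖χ a₀‖) ^ 2 / (Nt / snr) := by
          gcongr
          exact ha₀ a
      _ = 2 * (B * 2 * ‖χ a₀‖) ^ 2 * (r ^ 2 * snr) / Nt := by field_simp
      _ = R := by rw [hr2, inv_mul_cancel₀ hsnr0.ne', mul_one]
  have hint : ENNReal.ofReal (ε.toReal * b ^ (Mr * Mt * L) * (snr ^ (Mr * Mt * L))⁻¹) ≤
      ∫⁻ α : Fin Mr × Fin Mt × Fin L → ℂ,
        conditionalBER g χ π dec (fun k s => C.gain Nr Nt α k s) N₀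
        ∂(Measure.pi fun _ => complexGaussian 1) := by
    calc _ = ε * ENNReal.ofReal (b * r ^ 2) ^ (Mr * Mt * L) := by
          rw [mul_assoc, ENNReal.ofReal_mul ENNReal.toReal_nonneg, ENNReal.ofReal_toReal hεt,
            ← ENNReal.ofReal_pow (by positivity), hr2, mul_pow, inv_pow]
      _ ≤ ε * (Measure.pi fun _ : Fin Mr × Fin Mt × Fin L => complexGaussian 1) S := by
          gcongr
          rw [Measure.pi_pi, Finset.prod_const]
          simp only [Finset.card_univ, Fintype.card_prod, Fintype.card_fin, ← mul_assoc]
          gcongr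
          exact hball r hr0 hr1
      _ = ∫⁻ α, S.indicator (fun _ => ε) α
            ∂(Measure.pi fun _ : Fin Mr × Fin Mt × Fin L => complexGaussian 1) :=
          (lintegral_indicator_const hS _).symm
      _ ≤ _ := lintegral_mono fun α => Set.indicator_apply_le' (hcond α) fun _ => zero_le
  exact (ENNReal.ofReal_le_iff_le_toReal (ne_top_of_le_ne_top ENNReal.one_ne_top
    (lintegral_conditionalBER_le_one C g χ π dec Nr Nt N₀))).1 hint

end System

/-! ### Diversity gain from polynomial bounds -/

theorem tendsto_neg_log_mul_inv_pow_div_log {a : ℝ} (ha : 0 < a) (D : ℕ) :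
    Tendsto (fun x : ℝ => -Real.log (a * (x ^ D)⁻¹) / Real.log x) atTop (𝓝 (D : ℝ)) := by
  have h : Tendsto (fun x : ℝ => -Real.log a / Real.log x + D) atTop (𝓝 (D : ℝ)) := by
    simpa using (Real.tendsto_log_atTop.const_div_atTop (-Real.log a)).add_const (D : ℝ)
  refine h.congr' ?_
  filter_upwards [eventually_gt_atTop 1] with x hx
  have hlog := Real.log_pos hx
  rw [Real.log_mul ha.ne' (by positivity), Real.log_inv, Real.log_pow]
  field_simp
  ring

theorem tendsto_neg_log_div_log {P : ℝ → ℝ} {a b : ℝ} (ha : 0 < a) {D : ℕ}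
    (hle : ∀ x, 1 ≤ x → a * (x ^ D)⁻¹ ≤ P x) (hge : ∀ x, 1 ≤ x → P x ≤ b * (x ^ D)⁻¹) :
    Tendsto (fun x : ℝ => -Real.log (P x) / Real.log x) atTop (𝓝 (D : ℝ)) := by
  have hb : 0 < b := by
    have := (hle 1 le_rfl).trans (hge 1 le_rfl)
    simp only [one_pow, inv_one, mul_one] at this
    exact ha.trans_le this
  refine tendsto_of_tendsto_of_tendsto_of_le_of_le' (tendsto_neg_log_mul_inv_pow_div_log hb D)
    (tendsto_neg_log_mul_inv_pow_div_log ha D) ?_ ?_ <;>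
  filter_upwards [eventually_gt_atTop 1] with x hx <;>
  have hlog := Real.log_pos hx <;>
  have h1 := hle x hx.le <;>
  have h2 := hge x hx.le <;>
  have h0 : 0 < a * (x ^ D)⁻¹ := by positivity
  · have : 0 < P x := h0.trans_le h1
    gcongr
  · gcongr

theorem diversityGain_eq_of_tendsto {P : ℝ → ℝ} {d : ℝ}
    (h : Tendsto (fun x : ℝ => -Real.log (P x) / Real.log x) atTop (𝓝 d)) :
    diversityGain P = (d : EReal) :=
  ((continuous_coe_real_ereal.tendsto d).comp h).liminf_eq

/-- Lowering the exponent is harmless for x ≥ 1. For x ≤ 1 the trivial bound p ≤ 1 ≤ x^(-G) takes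
over, whence c + 1. -/
theorem le_mul_rpow_neg_of_le {p c x : ℝ} {D G : ℕ} (hc : 0 ≤ c) (hx : 0 < x) (hp : p ≤ 1)
    (h : p ≤ c * (x ^ D)⁻¹) (hGD : G ≤ D) : p ≤ (c + 1) * x ^ (-(G : ℝ)) := by
  rw [Real.rpow_neg hx.le, Real.rpow_natCast]
  rcases le_total 1 x with h1 | h1
  · calc p ≤ c * (x ^ D)⁻¹ := h
      _ ≤ c * (x ^ G)⁻¹ := by gcongr
      _ ≤ _ := by gcongr; linarith
  · have h2 : 1 ≤ (x ^ G)⁻¹ := (one_le_inv₀ (by positivity)).2 (pow_le_one₀ hx.le h1)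
    nlinarith

end BICMB

theorem mainTheorem1
    {Mr Mt L K Ns m kc nc ν T : ℕ}
    (hMr : 0 < Mr) (hMt : 0 < Mt) (hL : 0 < L) (hT : 0 < T) (hkc : 0 < kc)
    (C : BICMB.Channel Mr Mt L) (hC : C.PathsDistinct)
    (g : BICMB.ConvEncoder kc nc ν)
    (hg : Function.Injective (BICMB.codeword g : BICMB.Message T kc → Fin ((T + ν) * nc) → ZMod 2))
    (χ : (Fin m → ZMod 2) → ℂ) (hχ : Function.Injective χ)
    (π : BICMB.Interleaver ((T + ν) * nc) K Ns m) (hπ : BICMB.DesignCriteria g π)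
    (dec : BICMB.Decoder K Ns T kc) (hdec : BICMB.IsMLDecoder g χ π dec) :
    ∃ N₀ : ℕ, ∃ c : ℝ, 0 < c ∧ ∀ Nr Nt : ℕ, N₀ ≤ Nr → N₀ ≤ Nt →
      -- the diversity gain is achieved
      ((min g.freeDistance (Mr * Mt * L) : ℕ) : EReal) ≤
          BICMB.diversityGain (BICMB.bitErrorRate C g χ π dec Nr Nt) ∧
      -- the bound is uniform in the numbers of antennas
      (∀ snr : ℝ, 0 < snr →
        BICMB.bitErrorRate C g χ π dec Nr Nt snr ≤
          c * (Nr * snr) ^ (-((min g.freeDistance (Mr * Mt * L) : ℕ) : ℝ))) ∧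
      -- the full diversity gain is exact
      (Mr * Mt * L ≤ g.freeDistance →
        Tendsto (fun snr : ℝ =>
            -Real.log (BICMB.bitErrorRate C g χ π dec Nr Nt snr) / Real.log snr)
          atTop (𝓝 ((min g.freeDistance (Mr * Mt * L) : ℕ) : ℝ))) := by
  obtain ⟨N₀, c, hN₀, hc, hupper⟩ :=
    BICMB.exists_bitErrorRate_le hMr hMt hL hT hkc C hC g hg hχ hπ hdec
  refine ⟨N₀, c + 1, by positivity, fun Nr Nt hNr hNt => ?_⟩
  have hNr' : (0 : ℝ) < Nr := by exact_mod_cast hN₀.trans_le hNr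
  obtain ⟨a, ha, hlower⟩ := BICMB.exists_le_bitErrorRate hT hkc C g χ π hdec (Nr := Nr)
    (hN₀.trans_le hNt)
  have hlim : Tendsto (fun snr : ℝ =>
      -Real.log (BICMB.bitErrorRate C g χ π dec Nr Nt snr) / Real.log snr)
      atTop (𝓝 ((Mr * Mt * L : ℕ) : ℝ)) := by
    -- For fixed Nr, its power is absorbed into the constant, which does not affect the exponent.
    refine BICMB.tendsto_neg_log_div_log (b := c * ((Nr : ℝ) ^ (Mr * Mt * L))⁻¹) ha hlower
      fun snr hsnr => (hupper Nr Nt hNr hNt snr (by linarith)).trans_eq ?_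
    rw [mul_pow, mul_inv, ← mul_assoc]
  refine ⟨?_, fun snr hsnr => ?_, fun h => ?_⟩
  · rw [BICMB.diversityGain_eq_of_tendsto hlim, EReal.coe_natCast]
    exact Nat.cast_le.2 (min_le_right _ _)
  · exact BICMB.le_mul_rpow_neg_of_le hc.le (by positivity)
      (BICMB.bitErrorRate_le_one C g χ π dec Nr Nt snr) (hupper Nr Nt hNr hNt snr hsnr)
      (min_le_right _ _)
  · rw [min_eq_right h]
    exact hlim
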